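/- **Setting.** Let $1\le p_0<\infty$ and let $b:\mathbb R\times[0,\infty)\to\mathbb R$ be bounded and continuously differentiable. Put $$B(t)=\tfrac12\Big(\sup_{x}b(x,t)-\inf_{x}b(x,t)\Big),\qquad \beta(t)=\tfrac12\Big(\sup_{x}b(x,t)+\inf_{x}b(x,t)\Big),$$ $$C_2=\Big(\frac{3\sqrt3}{4\pi}\Big)^{1/3},\qquad C_\infty=\Big(\frac34\Big)^{2/3}.$$ Let $0<T_*\le\infty$ and let $u:\mathbb R\times[0,T_*)\to\mathbb R$ be a solution of $$u_t+(b\,u)_x=u_{xx},\qquad u(\cdot,0)\in L^{p_0}(\mathbb R)\cap L^\infty(\mathbb R),$$ that is: $u\in L^\infty_{\rm loc}([0,T_*),L^\infty(\mathbb R))$; the functions $u,u_t,u_x,u_{xx}$ exist and are continuous on $\mathbb R\times(0,T_*)$ and the equation holds there pointwise; and $u(\cdot,t)\to u(\cdot,0)$ in $L^1_{\rm loc}(\mathbb R)$ as $t\to0^+$. **Theorem 2.2.** Let $q\ge 2p_0$. Then $u(\cdot,t)\in L^{q/2}(\mathbb R)\cap L^q(\mathbb R)$ for every $t\in[0,T_*)$.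 Let $E_q\subset[0,T_*)$ be the set of times $t$ at which the identity $$\frac{d}{dt}\|u(\cdot,t)\|_{L^q}^q+q(q-1)\int_{\mathbb R}|u|^{q-2}|u_x|^2\,dx=q(q-1)\int_{\mathbb R}\big(b(x,t)-\beta(t)\big)|u|^{q-2}u\,u_x\,dx$$ fails to hold with all its terms well defined, i.e. with $u(\cdot,t)$ differentiable on $\mathbb R$, both integrands integrable, and $\|u(\cdot,t)\|_{L^q}^q$ differentiable in time (one-sided at $t=0$). Then $E_q$ has Lebesgue measure zero, and for every $\hat t\in[0,T_*)\setminus E_q$ with $\frac{d}{dt}\|u(\cdot,t)\|_{L^q}^q\big|_{t=\hat t}\ge0$ we have $$\|u(\cdot,\hat t)\|_{L^q(\mathbb R)}\le\Big(\frac q2\,C_2^3\Big)^{1/q}B(\hat t)^{1/q}\,\|u(\cdot,\hat t)\|_{L^{q/2}(\mathbb R)}$$ and $$\|u(\cdot,\hat t)\|_{L^\infty(\mathbb R)}\le\Big(\frac q2\,C_2\,C_\infty\Big)^{2/q}B(\hat t)^{2/q}\,\|u(\cdot,\hat t)\|_{L^{q/2}(\mathbb R)}.$$ -/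

import Mathlib

open MeasureTheory Filter Topology Set

noncomputable section

/-- Partial derivative in the space variable of a function of `(x, t)`. -/
def spaceDeriv (u : ℝ → ℝ → ℝ) (x t : ℝ) : ℝ := deriv (fun y => u y t) x

/-- Partial derivative in the time variable of a function of `(x, t)`. -/
def timeDeriv (u : ℝ → ℝ → ℝ) (x t : ℝ) : ℝ := deriv (fun s => u x s) t

/-- The open space-time region `ℝ × (0, T)`, with `T` possibly `∞`. -/
def openStrip (T : EReal) : Set (ℝ × ℝ) := {z | 0 < z.2 ∧ (z.2 : EReal) < T}

/-- A bounded, continuously differentiable advection field on `ℝ × [0, ∞)`. -/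
structure IsAdvectionField (b : ℝ → ℝ → ℝ) : Prop where
  contDiffOn : ContDiffOn ℝ 1 (fun z : ℝ × ℝ => b z.1 z.2) (univ ×ˢ Ici (0 : ℝ))
  bounded : ∃ M : ℝ, ∀ x t : ℝ, 0 ≤ t → |b x t| ≤ M

/-- Half the spatial oscillation of `b` at time `t`. -/
def halfOsc (b : ℝ → ℝ → ℝ) (t : ℝ) : ℝ := (1 / 2) * ((⨆ x, b x t) - ⨅ x, b x t)

/-- The midpoint of the spatial range of `b` at time `t`. -/
def midValue (b : ℝ → ℝ → ℝ) (t : ℝ) : ℝ := (1 / 2) * ((⨆ x, b x t) + ⨅ x, b x t)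

/-- `u` solves `u_t + (b u)_x = u_xx` on `ℝ × [0, T)`, with initial value
`u(·, 0)` in `L^{p₀} ∩ L^∞`. -/
structure IsSolution (b : ℝ → ℝ → ℝ) (p₀ : ℝ) (T : EReal) (u : ℝ → ℝ → ℝ) : Prop where
  /-- the initial value is in `L^{p₀}` -/
  initial_memLp : MemLp (fun x => u x 0) (ENNReal.ofReal p₀) volume
  /-- `u` is bounded on `ℝ × [0, S]` for every `S < T`; at `S = 0` this includes that the initial
  value is in `L^∞` -/
  bounded : ∀ S : ℝ, (S : EReal) < T →
    ∃ M : ℝ, ∀ t : ℝ, 0 ≤ t → t ≤ S → ∀ᵐ x ∂volume, |u x t| ≤ M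
  /-- `u` is `C²` in `x` and `C¹` in `t` on `ℝ × (0, T)` -/
  differentiableAt_space : ∀ z ∈ openStrip T, DifferentiableAt ℝ (fun y => u y z.2) z.1
  differentiableAt_space_space :
    ∀ z ∈ openStrip T, DifferentiableAt ℝ (fun y => spaceDeriv u y z.2) z.1
  differentiableAt_time : ∀ z ∈ openStrip T, DifferentiableAt ℝ (fun s => u z.1 s) z.2
  continuousOn : ContinuousOn (fun z : ℝ × ℝ => u z.1 z.2) (openStrip T)
  continuousOn_space : ContinuousOn (fun z : ℝ × ℝ => spaceDeriv u z.1 z.2) (openStrip T)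
  continuousOn_space_space :
    ContinuousOn (fun z : ℝ × ℝ => spaceDeriv (spaceDeriv u) z.1 z.2) (openStrip T)
  continuousOn_time : ContinuousOn (fun z : ℝ × ℝ => timeDeriv u z.1 z.2) (openStrip T)
  /-- the equation holds in the classical sense on `ℝ × (0, T)` -/
  equation : ∀ z ∈ openStrip T,
    timeDeriv u z.1 z.2 + spaceDeriv (fun y s => b y s * u y s) z.1 z.2
      = spaceDeriv (spaceDeriv u) z.1 z.2
  /-- the initial value is attained in `L¹_loc` -/
  initial_tendsto : ∀ K : Set ℝ, IsCompact K →
    Tendsto (fun t => ∫ x in K, |u x t - u x 0|) (𝓝[>] 0) (𝓝 0)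

/-- The function `t ↦ ‖u(·, t)‖_q ^ q`. -/
def normPow (u : ℝ → ℝ → ℝ) (q t : ℝ) : ℝ :=
  (eLpNorm (fun x => u x t) (ENNReal.ofReal q) volume).toReal ^ q

/-- The differential energy identity
`d/dt ‖u‖_q^q + q (q-1) ∫ |u|^(q-2) u_x² = q (q-1) ∫ (b - β) |u|^(q-2) u u_x`
holds at time `t`, all of its terms being well defined. The time derivative is two-sided for
`t > 0` and one-sided at `t = 0`. Differentiability in `x` is automatic for solutions at positive
times; it is there to give `u_x` a meaning at `t = 0`. -/
structure EnergyIdentityAt (b u : ℝ → ℝ → ℝ) (q t : ℝ) : Prop where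
  differentiable : Differentiable ℝ (fun x => u x t)
  integrable_dissipation :
    Integrable (fun x => |u x t| ^ (q - 2) * |spaceDeriv u x t| ^ 2) volume
  integrable_advection :
    Integrable (fun x => (b x t - midValue b t) * |u x t| ^ (q - 2) * u x t * spaceDeriv u x t)
      volume
  differentiableWithinAt : DifferentiableWithinAt ℝ (normPow u q) (Ici 0) t
  identity :
    derivWithin (normPow u q) (Ici 0) t
        + q * (q - 1) * ∫ x, |u x t| ^ (q - 2) * |spaceDeriv u x t| ^ 2
      = q * (q - 1) *
        ∫ x, (b x t - midValue b t) * |u x t| ^ (q - 2) * u x t * spaceDeriv u x t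

/-- The set `E_q` of exceptional times in `[0, T)`: those where the energy identity fails. -/
def exceptionalTimes (b u : ℝ → ℝ → ℝ) (T : EReal) (q : ℝ) : Set ℝ :=
  {t | 0 ≤ t ∧ (t : EReal) < T ∧ ¬ EnergyIdentityAt b u q t}

/-- The optimal constant `C₂` in the one-dimensional Nash inequality. -/
def nashConst : ℝ := (3 * √3 / (4 * Real.pi)) ^ (1 / 3 : ℝ)

/-- The constant `C_∞` of the inequality `‖v‖_∞ ≤ C_∞ ‖v‖_1^(1/3) ‖v_x‖_2^(2/3)`. -/
def supConst : ℝ := (3 / 4) ^ (2 / 3 : ℝ)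

end

/-! Put p = q/2 and v = |u|^p at a fixed time. Then ‖u‖_q^q = ‖v‖₂², ‖u‖_p^p = ‖v‖₁, and the
dissipation integral is ‖v_x‖₂²/p². If the energy identity holds and the time derivative is
nonnegative, the dissipation is at most the advection integral. Since |b - β| ≤ B, Young's
inequality absorbs half of it, leaving ‖v_x‖₂ ≤ pB ‖v‖₂ (`EnergyIdentityAt.dissipation_le`). Both
estimates follow by inserting this into the sharp inequalities ‖v‖₂³ ≤ C₂³ ‖v‖₁² ‖v_x‖₂ and ‖v‖_∞³ ≤
(9/16) ‖v‖₁ ‖v_x‖₂².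

The sharp inequalities need no rearrangement. As v vanishes at ±∞, every primitive G(v) = ∫₀^v g
satisfies 2|G(v)| ≤ ∫ |g(v) v_x| (`two_mul_abs_integral_le`). The choice g(s) = √s gives the sup
bound, and g(s) = √(s(M - s)) with M = max v gives Nash, after the arithmetic-geometric mean
inequality and optimization over a free scale.

For the null set, the equation is tested against η'(u) times a cutoff. A regularized power η and
Gronwall give L^p bounds uniform in cutoff and regularization, hence on the whole line. With η(s) =
|s|^q, the same balance makes the dissipation integrable on compact time slabs; letting the cutoff
tend to 1 shows that ‖u‖_q^q is an indefinite integral in time. Lebesgue differentiation yields the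
identity almost everywhere. Subtracting β is free because |u|^(q-2) u u_x is a derivative with zero
integral. -/

theorem abs_rpow_sub_one_sq (p s : ℝ) :
    (|s| ^ (p - 1)) ^ 2 = |s| ^ (2 * p - 2) := by
  rw [← Real.rpow_natCast, ← Real.rpow_mul (abs_nonneg s)]
  congr 1; push_cast; ring

theorem abs_rpow_sq (p s : ℝ) : (|s| ^ p) ^ 2 = |s| ^ (2 * p) := by
  rw [← Real.rpow_natCast, ← Real.rpow_mul (abs_nonneg s)]
  congr 1; push_cast; ring


theorem abs_rpow_sub_two_mul_sq {q : ℝ} (hq : 2 ≤ q) (s : ℝ) :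
    |s| ^ (q - 2) * s ^ 2 = |s| ^ q := by
  rcases eq_or_ne s 0 with rfl | hs
  · simp [Real.zero_rpow (by linarith : q ≠ 0)]
  · rw [← sq_abs s, ← Real.rpow_add_natCast (abs_ne_zero.2 hs)]
    congr 1; push_cast; ring

/-! ### Sharp one-dimensional interpolation inequalities for v = |w|^p. -/

section Sharp

variable {p : ℝ} {w w' : ℝ → ℝ}

/-- The derivative of `|w|^(2p)` is integrable up to its constant factor. -/
theorem integrable_abs_rpow_mul_deriv (hp : 1 ≤ p) (hw : ∀ x, HasDerivAt w (w' x) x)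
    (hX : Integrable fun x => |w x| ^ (2 * p))
    (hI : Integrable fun x => |w x| ^ (2 * p - 2) * w' x ^ 2) :
    Integrable fun x => |w x| ^ (2 * p - 2) * w x * w' x := by
  have hwc : Continuous w := continuous_iff_continuousAt.2 fun x => (hw x).continuousAt
  have hwm : Measurable w' := by
    have : w' = deriv w := funext fun x => (hw x).deriv.symm
    rw [this]; exact measurable_deriv w
  refine (hX.add hI).mono' ?_ (ae_of_all _ fun x => ?_)
  · exact (((hwc.abs.measurable.pow_const _).mul hwc.measurable).mul hwm).aestronglyMeasurable
  · simp only [Pi.add_apply, Real.norm_eq_abs]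
    rw [← abs_rpow_sub_two_mul_sq (by linarith : 2 ≤ 2 * p), mul_assoc, abs_mul,
      abs_of_nonneg (by positivity : 0 ≤ |w x| ^ (2 * p - 2)), ← mul_add]
    gcongr
    rw [abs_mul]
    nlinarith [sq_nonneg (|w x| - |w' x|), sq_abs (w x), sq_abs (w' x), sq_nonneg (w x),
      sq_nonneg (w' x)]

theorem hasDerivAt_abs_rpow_comp (hp : 1 ≤ p) (hw : ∀ x, HasDerivAt w (w' x) x) (x : ℝ) :
    HasDerivAt (fun x => |w x| ^ (2 * p)) (2 * p * (|w x| ^ (2 * p - 2) * w x * w' x)) x := by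
  have := (hasDerivAt_abs_rpow (w x) (by linarith : 1 < 2 * p)).comp x (hw x)
  exact this.congr_deriv (by ring)

/-- An integrable function with integrable derivative tends to 0 at ±∞; this applies to `|w|^(2p)`,
which is differentiable even where `w` vanishes. -/
theorem tendsto_zero_of_integrable_abs_rpow (hp : 1 ≤ p) (hw : ∀ x, HasDerivAt w (w' x) x)
    (hX : Integrable fun x => |w x| ^ (2 * p))
    (hI : Integrable fun x => |w x| ^ (2 * p - 2) * w' x ^ 2) :
    Tendsto w atTop (𝓝 0) ∧ Tendsto w atBot (𝓝 0) := by
  have hd := hasDerivAt_abs_rpow_comp hp hw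
  have hi := (integrable_abs_rpow_mul_deriv hp hw hX hI).const_mul (2 * p)
  have key : ∀ l : Filter ℝ, Tendsto (fun x => |w x| ^ (2 * p)) l (𝓝 0) → Tendsto w l (𝓝 0) := by
    intro l hl
    have h2 : Tendsto (fun x => (|w x| ^ (2 * p)) ^ (2 * p)⁻¹) l (𝓝 (0 ^ (2 * p)⁻¹)) :=
      hl.rpow_const (Or.inr (by positivity))
    rw [Real.zero_rpow (by positivity)] at h2
    rw [tendsto_zero_iff_abs_tendsto_zero]
    refine h2.congr fun x => ?_
    rw [Real.rpow_rpow_inv (abs_nonneg _) (by positivity)]; rfl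
  exact ⟨key _ (tendsto_zero_of_hasDerivAt_of_integrableOn_Ioi (a := 0) (fun x _ => hd x)
      hi.integrableOn hX.integrableOn),
    key _ (tendsto_zero_of_hasDerivAt_of_integrableOn_Iic (a := 0) (fun x _ => hd x)
      hi.integrableOn hX.integrableOn)⟩

/-- A function vanishing at `±∞` is bounded by half its total variation. -/
theorem two_mul_abs_le_integral_abs_deriv {F F' : ℝ → ℝ} (hF : ∀ x, HasDerivAt F (F' x) x)
    (hi : Integrable F') (htop : Tendsto F atTop (𝓝 0)) (hbot : Tendsto F atBot (𝓝 0)) (x : ℝ) :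
    2 * |F x| ≤ ∫ y, |F' y| := by
  have h1 := integral_Ioi_of_hasDerivAt_of_tendsto' (a := x) (fun y _ => hF y)
    hi.integrableOn htop
  have h2 := integral_Iic_of_hasDerivAt_of_tendsto' (a := x) (fun y _ => hF y)
    hi.integrableOn hbot
  have h3 : |∫ y in Ioi x, F' y| ≤ ∫ y in Ioi x, |F' y| := abs_integral_le_integral_abs
  have h4 : |∫ y in Iic x, F' y| ≤ ∫ y in Iic x, |F' y| := abs_integral_le_integral_abs
  rw [h1, zero_sub, abs_neg] at h3
  rw [h2, sub_zero] at h4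
  rw [← intervalIntegral.integral_Iic_add_Ioi hi.abs.integrableOn hi.abs.integrableOn (b := x)]
  linarith

theorem integral_rpow_mul_comp_rpow (hp : 1 ≤ p) {g : ℝ → ℝ} (hg : Continuous g) {m : ℝ}
    (hm : 0 ≤ m) :
    ∫ s in (0 : ℝ)..m, p * |s| ^ (p - 1) * g (|s| ^ p) = ∫ s in (0 : ℝ)..(m ^ p), g s := by
  have := intervalIntegral.integral_comp_mul_deriv (a := 0) (b := m) (f := fun s : ℝ => s ^ p)
    (f' := fun s => p * s ^ (p - 1)) (g := g)
    (fun x _ => by simpa using Real.hasDerivAt_rpow_const (x := x) (Or.inr hp))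
    (Continuous.continuousOn (continuous_const.mul
      (Real.continuous_rpow_const (by linarith)))) hg
  rw [Real.zero_rpow (by linarith)] at this
  rw [← this]
  refine intervalIntegral.integral_congr fun s hs => ?_
  rw [uIcc_of_le hm] at hs
  simp only [abs_of_nonneg hs.1, Function.comp]
  ring

/-- The total variation bound is applied to `H ∘ w`, where `H` is the primitive of `p |s|^(p-1)
g(|s|^p)`. As `H` is odd, `|H (w x)|` is the integral of `g` up to `|w x|^p`. Working with `H`
avoids differentiating `|w|^p`, which for p = 1 can fail at zeros of `w`. -/
theorem two_mul_abs_integral_le (hp : 1 ≤ p) (hw : ∀ x, HasDerivAt w (w' x) x)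
    (htop : Tendsto w atTop (𝓝 0)) (hbot : Tendsto w atBot (𝓝 0))
    {g : ℝ → ℝ} (hg : Continuous g)
    (hi : Integrable fun x => p * |w x| ^ (p - 1) * g (|w x| ^ p) * w' x) (x : ℝ) :
    2 * |∫ s in (0 : ℝ)..(|w x| ^ p), g s| ≤
      ∫ y, |p * |w y| ^ (p - 1) * g (|w y| ^ p) * w' y| := by
  set h : ℝ → ℝ := fun s => p * |s| ^ (p - 1) * g (|s| ^ p) with hh
  have hc : Continuous h := by
    refine (continuous_const.mul (continuous_abs.rpow_const fun _ => Or.inr (by linarith))).mul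
      (hg.comp (continuous_abs.rpow_const fun _ => Or.inr (by linarith)))
  set H : ℝ → ℝ := fun s => ∫ y in (0 : ℝ)..s, h y with hH
  have hHd : ∀ s, HasDerivAt H (h s) s := fun s =>
    intervalIntegral.integral_hasDerivAt_right (hc.intervalIntegrable _ _)
      (hc.stronglyMeasurableAtFilter _ _) hc.continuousAt
  have hHc : Continuous H := continuous_iff_continuousAt.2 fun s => (hHd s).continuousAt
  have hH0 : H 0 = 0 := by simp [hH]
  have hlim : ∀ l : Filter ℝ, Tendsto w l (𝓝 0) → Tendsto (fun x => H (w x)) l (𝓝 0) := by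
    intro l hl
    have := (hHc.tendsto 0).comp hl
    rwa [hH0] at this
  have key := two_mul_abs_le_integral_abs_deriv (F := fun x => H (w x))
    (F' := fun x => h (w x) * w' x) (fun x => (hHd (w x)).comp x (hw x)) hi
    (hlim _ htop) (hlim _ hbot) x
  have habs : |H (w x)| = |∫ s in (0 : ℝ)..(|w x| ^ p), g s| := by
    rw [← integral_rpow_mul_comp_rpow hp hg (abs_nonneg (w x))]
    change |H (w x)| = |H (|w x|)|
    rcases abs_cases (w x) with ⟨h1, -⟩ | ⟨h1, -⟩
    · rw [h1]
    · have : H (-w x) = - H (w x) := by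
        have e := intervalIntegral.integral_comp_neg (a := 0) (b := w x) h
        have e2 : ∀ y, h (-y) = h y := fun y => by simp [hh]
        simp only [e2, neg_zero] at e
        simp only [hH]
        rw [e, intervalIntegral.integral_symm]
      rw [h1, this, abs_neg]
  rw [habs] at key
  exact key

/-- Optimization over the scale l, done through the discriminant so that A = 0 needs no separate
case. -/
theorem sq_le_mul_of_forall_two_mul_le {y A D : ℝ} (hy : 0 ≤ y) (hA : 0 ≤ A) (hD : 0 ≤ D)
    (h : ∀ l : ℝ, 0 < l → 2 * y * l ≤ A * l ^ 2 + D) : y ^ 2 ≤ A * D := by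
  have := discrim_le_zero (a := A) (b := -(2 * y)) (c := D) fun l => by
    rcases le_or_gt l 0 with hl | hl
    · nlinarith [mul_nonneg hA (mul_self_nonneg l), mul_nonneg hy (neg_nonneg.2 hl)]
    · nlinarith [h l hl]
  rw [discrim] at this
  nlinarith

theorem integral_sqrt_zero_left {V : ℝ} (hV : 0 ≤ V) :
    ∫ s in (0 : ℝ)..V, √s = 2 / 3 * (V * √V) := by
  have : ∀ s : ℝ, √s = s ^ (1 / 2 : ℝ) := Real.sqrt_eq_rpow
  simp only [this]
  rw [integral_rpow (Or.inl (by norm_num)), Real.zero_rpow (by norm_num),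
    Real.rpow_add' hV (by norm_num), Real.rpow_one]
  ring

/-- Sharp one-dimensional inequality `‖v‖_∞³ ≤ 9/16 ‖v‖₁ ‖v'‖₂²` for `v = |w|^p`. -/
theorem abs_rpow_pow_three_le (hp : 1 ≤ p) (hw : ∀ x, HasDerivAt w (w' x) x)
    (hA : Integrable fun x => |w x| ^ p) (hX : Integrable fun x => |w x| ^ (2 * p))
    (hI : Integrable fun x => |w x| ^ (2 * p - 2) * w' x ^ 2) (x : ℝ) :
    16 / 9 * (|w x| ^ p) ^ 3 ≤
      (∫ y, |w y| ^ p) * (p ^ 2 * ∫ y, |w y| ^ (2 * p - 2) * w' y ^ 2) := by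
  obtain ⟨htop, hbot⟩ := tendsto_zero_of_integrable_abs_rpow hp hw hX hI
  have hwc : Continuous w := continuous_iff_continuousAt.2 fun x => (hw x).continuousAt
  have hwm : Measurable w' := by
    have : w' = deriv w := funext fun x => (hw x).deriv.symm
    rw [this]; exact measurable_deriv w
  -- Arithmetic-geometric mean inequality for l√v and |v'|, with free weight l.
  have hpt : ∀ l : ℝ, 0 < l → ∀ y,
      |p * |w y| ^ (p - 1) * √(|w y| ^ p) * w' y| * (2 * l) ≤
        l ^ 2 * |w y| ^ p + p ^ 2 * (|w y| ^ (2 * p - 2) * w' y ^ 2) := by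
    intro l hl y
    have h1 : 0 ≤ |w y| ^ p := by positivity
    rw [← abs_rpow_sub_one_sq, abs_mul, abs_of_nonneg (by positivity :
      0 ≤ p * |w y| ^ (p - 1) * √(|w y| ^ p))]
    have h2 := two_mul_le_add_sq (l * √(|w y| ^ p)) (p * |w y| ^ (p - 1) * |w' y|)
    rw [mul_pow l, Real.sq_sqrt h1, mul_pow, mul_pow p, sq_abs] at h2
    linarith
  have hi : Integrable fun y => p * |w y| ^ (p - 1) * √(|w y| ^ p) * w' y := by
    refine (((hA.const_mul (1 ^ 2)).add (hI.const_mul (p ^ 2)))).mono'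
      (Measurable.aestronglyMeasurable ?_) (ae_of_all _ fun y => ?_)
    · exact (((hwc.abs.measurable.pow_const _).const_mul p).mul
        (hwc.abs.measurable.pow_const _).sqrt).mul hwm
    · have := hpt 1 one_pos y
      simp only [Pi.add_apply, Real.norm_eq_abs]
      nlinarith [abs_nonneg (p * |w y| ^ (p - 1) * √(|w y| ^ p) * w' y)]
  have key := two_mul_abs_integral_le hp hw htop hbot Real.continuous_sqrt hi x
  have hV : 0 ≤ |w x| ^ p := by positivity
  rw [integral_sqrt_zero_left hV, abs_of_nonneg (by positivity)] at key
  -- Here y = (4/3) v^(3/2), whose square produces the constant 16/9.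
  have hfin := sq_le_mul_of_forall_two_mul_le (y := 2 * (2 / 3 * (|w x| ^ p * √(|w x| ^ p))))
    (A := ∫ y, |w y| ^ p) (D := p ^ 2 * ∫ y, |w y| ^ (2 * p - 2) * w' y ^ 2)
    (by positivity) (integral_nonneg fun y => by positivity)
    (mul_nonneg (by positivity) (integral_nonneg fun y => by positivity)) fun l hl => by
      have h2 := integral_mono (hi.abs.mul_const (2 * l))
        ((hA.const_mul (l ^ 2)).add (hI.const_mul (p ^ 2))) (hpt l hl)
      simp only [Pi.add_apply] at h2
      rw [integral_mul_const, integral_add (hA.const_mul _) (hI.const_mul _),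
        integral_const_mul, integral_const_mul] at h2
      nlinarith
  rw [mul_pow, mul_pow, mul_pow, Real.sq_sqrt hV] at hfin
  linarith

/-- This is the area of a half disc of diameter M, the source of π in the Nash constant. -/
theorem integral_sqrt_mul_sub {M : ℝ} (hM : 0 ≤ M) :
    ∫ s in (0 : ℝ)..M, √(s * (M - s)) = Real.pi * M ^ 2 / 8 := by
  rcases hM.eq_or_lt with rfl | hM
  · simp
  have h := intervalIntegral.integral_comp_mul_add (a := -1) (b := 1)
    (fun s => √(s * (M - s))) (c := M / 2) (by positivity) (M / 2)
  have e : ∀ y : ℝ, √((M / 2 * y + M / 2) * (M - (M / 2 * y + M / 2))) =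
      M / 2 * √(1 - y ^ 2) := by
    intro y
    rw [show (M / 2 * y + M / 2) * (M - (M / 2 * y + M / 2)) = (M / 2) ^ 2 * (1 - y ^ 2) by ring,
      Real.sqrt_mul (by positivity), Real.sqrt_sq (by positivity)]
  simp only [e] at h
  rw [intervalIntegral.integral_const_mul, integral_sqrt_one_sub_sq,
    show M / 2 * -1 + M / 2 = 0 by ring, show M / 2 * 1 + M / 2 = M by ring, smul_eq_mul] at h
  field_simp at h ⊢
  linarith

/-- Scale-dependent form of the sharp one-dimensional Nash inequality for `v = |w|^p`. -/
theorem nash_with_scale (hp : 1 ≤ p) (hw : ∀ x, HasDerivAt w (w' x) x)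
    (hA : Integrable fun x => |w x| ^ p) (hX : Integrable fun x => |w x| ^ (2 * p))
    (hI : Integrable fun x => |w x| ^ (2 * p - 2) * w' x ^ 2) {k : ℝ} (hk : 0 < k) :
    k ^ 2 * (∫ y, |w y| ^ (2 * p)) - p ^ 2 * ∫ y, |w y| ^ (2 * p - 2) * w' y ^ 2 ≤
      k ^ 3 * (∫ y, |w y| ^ p) ^ 2 / (2 * Real.pi) := by
  obtain ⟨htop, hbot⟩ := tendsto_zero_of_integrable_abs_rpow hp hw hX hI
  have hwc : Continuous w := continuous_iff_continuousAt.2 fun x => (hw x).continuousAt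
  have hwm : Measurable w' := by
    have : w' = deriv w := funext fun x => (hw x).deriv.symm
    rw [this]; exact measurable_deriv w
  have hvc : Continuous fun x => |w x| ^ p := hwc.abs.rpow_const fun _ => Or.inr (by linarith)
  -- The maximum of v must be attained, so that the inequality for `g` can be evaluated at v = M.
  obtain ⟨x₀, hx₀⟩ : ∃ x₀, ∀ x, |w x| ^ p ≤ |w x₀| ^ p := by
    by_cases h0 : ∀ x, w x = 0
    · exact ⟨0, fun x => by simp [h0]⟩
    push Not at h0
    obtain ⟨y, hy⟩ := h0
    refine hvc.exists_forall_ge' y ?_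
    have hpos : 0 < |w y| ^ p := Real.rpow_pos_of_pos (abs_pos.2 hy) _
    have hlim : Tendsto (fun x => |w x| ^ p) (cocompact ℝ) (𝓝 0) := by
      have h1 : Tendsto w (cocompact ℝ) (𝓝 0) := by
        rw [cocompact_eq_atBot_atTop]; exact hbot.sup htop
      have h2 := h1.abs.rpow_const (p := p) (Or.inr (by linarith))
      simpa [Real.zero_rpow (by linarith : p ≠ 0)] using h2
    filter_upwards [hlim.eventually (eventually_lt_nhds hpos)] with x hx using hx.le
  set M := |w x₀| ^ p with hMdef
  have hM : 0 ≤ M := by positivity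
  -- The square of this weight is Mv - v², so its integral brings in ‖v‖₂² with the favourable sign.
  have hg : Continuous fun s : ℝ => √(s * (M - s)) := by fun_prop
  have hpt : ∀ y, |p * |w y| ^ (p - 1) * √(|w y| ^ p * (M - |w y| ^ p)) * w' y| * (2 * k) ≤
      p ^ 2 * (|w y| ^ (2 * p - 2) * w' y ^ 2) +
        (k ^ 2 * M * |w y| ^ p - k ^ 2 * |w y| ^ (2 * p)) := by
    intro y
    have h0 : 0 ≤ |w y| ^ p := by positivity
    have h1 : 0 ≤ |w y| ^ p * (M - |w y| ^ p) := mul_nonneg h0 (sub_nonneg.2 (hx₀ y))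
    rw [← abs_rpow_sub_one_sq, ← abs_rpow_sq, abs_mul, abs_of_nonneg (by positivity :
      0 ≤ p * |w y| ^ (p - 1) * √(|w y| ^ p * (M - |w y| ^ p)))]
    have h2 := two_mul_le_add_sq (k * √(|w y| ^ p * (M - |w y| ^ p)))
      (p * |w y| ^ (p - 1) * |w' y|)
    rw [mul_pow k, Real.sq_sqrt h1, mul_pow, mul_pow p, sq_abs] at h2
    linarith
  have hAX : Integrable fun y => k ^ 2 * M * |w y| ^ p - k ^ 2 * |w y| ^ (2 * p) :=
    (hA.const_mul _).sub (hX.const_mul _)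
  have hR : Integrable fun y => p ^ 2 * (|w y| ^ (2 * p - 2) * w' y ^ 2) +
        (k ^ 2 * M * |w y| ^ p - k ^ 2 * |w y| ^ (2 * p)) :=
    (hI.const_mul _).add hAX
  have hi : Integrable fun y =>
      p * |w y| ^ (p - 1) * √(|w y| ^ p * (M - |w y| ^ p)) * w' y := by
    refine (hR.div_const (2 * k)).mono'
      (Measurable.aestronglyMeasurable ?_) (ae_of_all _ fun y => ?_)
    · exact (((hwc.abs.measurable.pow_const _).const_mul p).mul
        (hg.measurable.comp (hwc.abs.measurable.pow_const _))).mul hwm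
    · rw [Real.norm_eq_abs, le_div_iff₀ (by positivity)]
      exact hpt y
  have key := two_mul_abs_integral_le hp hw htop hbot hg hi x₀
  rw [integral_sqrt_mul_sub hM, abs_of_nonneg (by positivity)] at key
  have h2 := integral_mono (hi.abs.mul_const (2 * k)) hR hpt
  rw [integral_mul_const, integral_add (hI.const_mul _) hAX,
    integral_sub (hA.const_mul _) (hX.const_mul _), integral_const_mul, integral_const_mul,
    integral_const_mul] at h2
  set A := ∫ y, |w y| ^ p
  have hpi := Real.pi_pos
  -- The maximum M is eliminated: the left side is a concave quadratic in M, largest at M = kA/π.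
  have h3 : k ^ 2 * M * A - Real.pi * M ^ 2 / 2 * k ≤ k ^ 3 * A ^ 2 / (2 * Real.pi) := by
    rw [le_div_iff₀ (by positivity)]
    nlinarith [mul_nonneg hk.le (sq_nonneg (k * A - Real.pi * M))]
  nlinarith

/-- Sharp Nash bound under control of the dissipation, `‖v'‖₂ ≤ κ ‖v‖₂`, for `v = |w|^p`. -/
theorem integral_le_of_dissipation_le (hp : 1 ≤ p) (hw : ∀ x, HasDerivAt w (w' x) x)
    (hA : Integrable fun x => |w x| ^ p) (hX : Integrable fun x => |w x| ^ (2 * p))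
    (hI : Integrable fun x => |w x| ^ (2 * p - 2) * w' x ^ 2) {κ : ℝ} (hκ : 0 ≤ κ)
    (hD : p ^ 2 * ∫ y, |w y| ^ (2 * p - 2) * w' y ^ 2 ≤ κ ^ 2 * ∫ y, |w y| ^ (2 * p)) :
    ∫ y, |w y| ^ (2 * p) ≤ 3 * √3 / (4 * Real.pi) * κ * (∫ y, |w y| ^ p) ^ 2 := by
  have hn := fun {k : ℝ} (hk : 0 < k) => nash_with_scale hp hw hA hX hI hk
  set X := ∫ y, |w y| ^ (2 * p)
  set A := ∫ y, |w y| ^ p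
  have hpi := Real.pi_pos
  rcases hκ.eq_or_lt with rfl | hκ
  -- For κ = 0 the scale inequality reads X ≤ kA²/(2π), and k tends to 0.
  · simp only [mul_zero, zero_mul]
    refine le_of_forall_pos_le_add fun ε hε => ?_
    have hA2 : 0 < A ^ 2 + 1 := by positivity
    have h1 := hn (k := ε * (2 * Real.pi) / (A ^ 2 + 1)) (by positivity)
    set k := ε * (2 * Real.pi) / (A ^ 2 + 1) with hkdef
    have hk : 0 < k := by positivity
    have hkA : k * A ^ 2 / (2 * Real.pi) ≤ ε := by
      rw [div_le_iff₀ (by positivity), hkdef, div_mul_eq_mul_div, div_le_iff₀ hA2]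
      nlinarith [mul_pos hε hpi]
    have h2 : k ^ 2 * X ≤ k ^ 2 * (k * A ^ 2 / (2 * Real.pi)) := by
      have : k ^ 3 * A ^ 2 / (2 * Real.pi) = k ^ 2 * (k * A ^ 2 / (2 * Real.pi)) := by ring
      nlinarith
    have := le_of_mul_le_mul_left h2 (by positivity)
    linarith
  -- The choice k = √3 κ minimizes k³/(k² - κ²).
  · have h1 := hn (k := √3 * κ) (by positivity)
    have h3 : (√3 : ℝ) ^ 2 = 3 := Real.sq_sqrt (by norm_num)
    have h4 : (√3 * κ) ^ 3 * A ^ 2 / (2 * Real.pi) =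
        2 * κ ^ 2 * (3 * √3 / (4 * Real.pi) * κ * A ^ 2) := by
      rw [mul_pow, pow_succ √3 2, h3]
      field_simp
      ring
    rw [h4, mul_pow, h3] at h1
    have : 2 * κ ^ 2 * X ≤ 2 * κ ^ 2 * (3 * √3 / (4 * Real.pi) * κ * A ^ 2) := by linarith
    exact le_of_mul_le_mul_left this (by positivity)

/-- Sup bound under control of the dissipation, `‖v'‖₂ ≤ κ ‖v‖₂`, for `v = |w|^p`. -/
theorem abs_rpow_pow_three_le_of_dissipation_le (hp : 1 ≤ p) (hw : ∀ x, HasDerivAt w (w' x) x)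
    (hA : Integrable fun x => |w x| ^ p) (hX : Integrable fun x => |w x| ^ (2 * p))
    (hI : Integrable fun x => |w x| ^ (2 * p - 2) * w' x ^ 2) {κ : ℝ} (hκ : 0 ≤ κ)
    (hD : p ^ 2 * ∫ y, |w y| ^ (2 * p - 2) * w' y ^ 2 ≤ κ ^ 2 * ∫ y, |w y| ^ (2 * p)) (x : ℝ) :
    (|w x| ^ p) ^ 3 ≤ 9 / 16 * (3 * √3 / (4 * Real.pi)) * (κ * ∫ y, |w y| ^ p) ^ 3 := by
  have h1 := integral_le_of_dissipation_le hp hw hA hX hI hκ hD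
  have h2 := abs_rpow_pow_three_le hp hw hA hX hI x
  set X := ∫ y, |w y| ^ (2 * p)
  have hA0 : 0 ≤ ∫ y, |w y| ^ p := integral_nonneg fun y => by positivity
  set A := ∫ y, |w y| ^ p
  -- The chain is (16/9) v³ ≤ A κ² X ≤ C₂³ (κA)³.
  have h3 := mul_le_mul_of_nonneg_left hD hA0
  have h4 := mul_le_mul_of_nonneg_left h1 (mul_nonneg hA0 (sq_nonneg κ))
  linarith

end Sharp

/-! ### Polynomial cutoffs. -/

/-- The cutoff weight `(1 - (x/R)²)²`, used on `[-R, R]`, where it vanishes to second order at the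
end points. -/
noncomputable def cutoff (R x : ℝ) : ℝ := (1 - (x / R) ^ 2) ^ 2

/-- First derivative of `cutoff`. -/
noncomputable def cutoffDeriv (R x : ℝ) : ℝ := -4 * x / R ^ 2 * (1 - (x / R) ^ 2)

/-- Second derivative of `cutoff`. -/
noncomputable def cutoffDeriv2 (R x : ℝ) : ℝ := -4 / R ^ 2 + 12 * x ^ 2 / R ^ 4

theorem hasDerivAt_cutoff (R x : ℝ) : HasDerivAt (cutoff R) (cutoffDeriv R x) x := by
  have h := ((((hasDerivAt_id x).div_const R).pow 2).const_sub 1).pow 2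
  refine h.congr_deriv ?_
  simp [cutoffDeriv]
  ring

theorem hasDerivAt_cutoffDeriv (R x : ℝ) :
    HasDerivAt (cutoffDeriv R) (cutoffDeriv2 R x) x := by
  have h := (((hasDerivAt_id x).const_mul (-4)).div_const (R ^ 2)).mul
    ((((hasDerivAt_id x).div_const R).pow 2).const_sub 1)
  refine h.congr_deriv ?_
  simp [cutoffDeriv2]
  ring

theorem continuous_cutoff (R : ℝ) : Continuous (cutoff R) := by
  unfold cutoff; fun_prop

theorem continuous_cutoffDeriv (R : ℝ) : Continuous (cutoffDeriv R) := by
  unfold cutoffDeriv; fun_prop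

theorem continuous_cutoffDeriv2 (R : ℝ) : Continuous (cutoffDeriv2 R) := by
  unfold cutoffDeriv2; fun_prop

theorem div_sq_le_one {R x : ℝ} (hR : 0 < R) (hx : x ∈ Icc (-R) R) : (x / R) ^ 2 ≤ 1 := by
  rw [div_pow, div_le_one (by positivity)]
  exact sq_le_sq' hx.1 hx.2

theorem cutoff_nonneg (R x : ℝ) : 0 ≤ cutoff R x := sq_nonneg _

theorem cutoff_le_one {R x : ℝ} (hR : 0 < R) (hx : x ∈ Icc (-R) R) : cutoff R x ≤ 1 := by
  have := div_sq_le_one hR hx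
  unfold cutoff
  nlinarith [sq_nonneg (x / R)]

theorem le_cutoff {R x : ℝ} (hR : 0 < R) (hx : x ∈ Icc (-(R / 2)) (R / 2)) :
    9 / 16 ≤ cutoff R x := by
  have : (x / R) ^ 2 ≤ 1 / 4 := by
    rw [div_pow, div_le_iff₀ (by positivity)]
    nlinarith [sq_le_sq' hx.1 hx.2]
  unfold cutoff
  nlinarith

theorem abs_cutoffDeriv_le {R x : ℝ} (hR : 1 ≤ R) (hx : x ∈ Icc (-R) R) :
    |cutoffDeriv R x| ≤ 4 / R := by
  have hR0 : 0 < R := by linarith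
  have h1 := div_sq_le_one hR0 hx
  have h2 : |x| ≤ R := abs_le.2 hx
  unfold cutoffDeriv
  rw [abs_mul, abs_of_nonneg (by linarith : 0 ≤ 1 - (x / R) ^ 2), abs_div, abs_mul,
    abs_of_nonneg (sq_nonneg R)]
  have h3 : |(-4 : ℝ)| * |x| / R ^ 2 ≤ 4 / R := by
    rw [div_le_div_iff₀ (by positivity) hR0]
    norm_num
    nlinarith [mul_le_mul_of_nonneg_right h2 hR0.le]
  calc _ ≤ |(-4 : ℝ)| * |x| / R ^ 2 * 1 := by
        gcongr; linarith [sq_nonneg (x / R)]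
    _ ≤ _ := by linarith

/-- The natural bound is 8/R²; it is weakened so that both derivatives share the rate 1/R, which is
just enough to offset an interval of length 2R. -/
theorem abs_cutoffDeriv2_le {R x : ℝ} (hR : 1 ≤ R) (hx : x ∈ Icc (-R) R) :
    |cutoffDeriv2 R x| ≤ 8 / R := by
  have hR0 : 0 < R := by linarith
  have h1 := div_sq_le_one hR0 hx
  have e : cutoffDeriv2 R x = (-4 + 12 * (x / R) ^ 2) / R ^ 2 := by
    unfold cutoffDeriv2; field_simp
  have h2 : |-4 + 12 * (x / R) ^ 2| ≤ 8 :=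
    abs_le.2 ⟨by linarith [sq_nonneg (x / R)], by linarith⟩
  rw [e, abs_div, abs_of_nonneg (sq_nonneg R), div_le_div_iff₀ (by positivity) hR0]
  nlinarith [mul_le_mul_of_nonneg_right h2 hR0.le]

theorem cutoff_right {R : ℝ} (hR : 0 < R) : cutoff R R = 0 := by simp [cutoff, hR.ne']
theorem cutoff_left {R : ℝ} (hR : 0 < R) : cutoff R (-R) = 0 := by
  simp [cutoff, hR.ne']
theorem cutoffDeriv_right {R : ℝ} (hR : 0 < R) : cutoffDeriv R R = 0 := by
  simp [cutoffDeriv, hR.ne']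
theorem cutoffDeriv_left {R : ℝ} (hR : 0 < R) : cutoffDeriv R (-R) = 0 := by
  simp [cutoffDeriv, hR.ne']

/-! ### Local entropy balance for solutions. -/

/-- The open time interval `(0, T)`. -/
def openTimes (T : EReal) : Set ℝ := {t | 0 < t ∧ (t : EReal) < T}

theorem isOpen_openTimes (T : EReal) : IsOpen (openTimes T) :=
  (isOpen_lt continuous_const continuous_id).inter
    (isOpen_lt continuous_coe_real_ereal continuous_const)

theorem Icc_subset_openTimes {T : EReal} {r s : ℝ} (hr : r ∈ openTimes T)
    (hs : s ∈ openTimes T) : Icc r s ⊆ openTimes T := fun _ h =>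
  ⟨hr.1.trans_le h.1, (EReal.coe_le_coe_iff.2 h.2).trans_lt hs.2⟩

theorem continuous_slice {T : EReal} {f : ℝ → ℝ → ℝ}
    (hf : ContinuousOn (fun z : ℝ × ℝ => f z.1 z.2) (openStrip T)) {t : ℝ}
    (ht : t ∈ openTimes T) : Continuous fun x => f x t :=
  hf.comp_continuous (by fun_prop : Continuous fun x : ℝ => (x, t)) fun _ => ht

theorem IsAdvectionField.continuousOn_strip {b : ℝ → ℝ → ℝ} (hb : IsAdvectionField b)
    (T : EReal) : ContinuousOn (fun z : ℝ × ℝ => b z.1 z.2) (openStrip T) :=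
  hb.contDiffOn.continuousOn.mono fun _ hz => ⟨mem_univ _, hz.1.le⟩

theorem IsAdvectionField.differentiableAt_space {b : ℝ → ℝ → ℝ} (hb : IsAdvectionField b)
    (x : ℝ) {t : ℝ} (ht : 0 ≤ t) : DifferentiableAt ℝ (fun y => b y t) x := by
  have h := hb.contDiffOn.differentiableOn one_ne_zero (x, t) ⟨mem_univ _, ht⟩
  have h2 : DifferentiableWithinAt ℝ (fun y : ℝ => (y, t)) univ x :=
    (by fun_prop : DifferentiableAt ℝ (fun y : ℝ => (y, t)) x).differentiableWithinAt
  have := DifferentiableWithinAt.comp (g := fun z : ℝ × ℝ => b z.1 z.2)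
    (t := univ ×ˢ Ici (0 : ℝ)) x h h2 fun y _ => ⟨mem_univ _, ht⟩
  exact differentiableWithinAt_univ.1 this

section Solution

variable {b u : ℝ → ℝ → ℝ} {p₀ : ℝ} {T : EReal}

theorem IsSolution.hasDerivAt_space (hu : IsSolution b p₀ T u) (x : ℝ) {t : ℝ}
    (ht : t ∈ openTimes T) : HasDerivAt (fun y => u y t) (spaceDeriv u x t) x :=
  (hu.differentiableAt_space (x, t) ht).hasDerivAt

theorem IsSolution.hasDerivAt_time (hu : IsSolution b p₀ T u) (x : ℝ) {t : ℝ}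
    (ht : t ∈ openTimes T) : HasDerivAt (fun s => u x s) (timeDeriv u x t) t :=
  (hu.differentiableAt_time (x, t) ht).hasDerivAt

/-- Keeping u_x - bu as a single flux means that b_x, which need not be bounded, never appears in an
estimate. -/
theorem IsSolution.hasDerivAt_flux (hb : IsAdvectionField b) (hu : IsSolution b p₀ T u) (x : ℝ)
    {t : ℝ} (ht : t ∈ openTimes T) :
    HasDerivAt (fun y => spaceDeriv u y t - b y t * u y t) (timeDeriv u x t) x := by
  have h1 := (hu.differentiableAt_space_space (x, t) ht).hasDerivAt
  have h2 := ((hb.differentiableAt_space x ht.1.le).mul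
    (hu.differentiableAt_space (x, t) ht)).hasDerivAt
  have h3 := hu.equation (x, t) ht
  refine (h1.sub h2).congr_deriv ?_
  simp only [spaceDeriv] at h3 ⊢
  change timeDeriv u x t + deriv ((fun y => b y t) * fun y => u y t) x = _ at h3
  linarith

/-- The spatial density of `d/dt ∫ η(u) φ_R`, after integration by parts. -/
noncomputable def entropyProduction (b u : ℝ → ℝ → ℝ) (η η' η'' : ℝ → ℝ) (R x t : ℝ) : ℝ :=
  η'' (u x t) * (b x t * u x t * spaceDeriv u x t - spaceDeriv u x t ^ 2) * cutoff R x
    + b x t * u x t * η' (u x t) * cutoffDeriv R x + η (u x t) * cutoffDeriv2 R x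

theorem continuousOn_entropyProduction (hb : IsAdvectionField b) (hu : IsSolution b p₀ T u)
    {η η' η'' : ℝ → ℝ} (hc : Continuous η) (hc' : Continuous η') (hc'' : Continuous η'') (R : ℝ) :
    ContinuousOn (fun z : ℝ × ℝ => entropyProduction b u η η' η'' R z.1 z.2) (openStrip T) := by
  have h1 := hu.continuousOn
  have h2 := hu.continuousOn_space
  have h3 := hb.continuousOn_strip T
  have hf : ∀ {f : ℝ → ℝ}, Continuous f → ContinuousOn (fun z : ℝ × ℝ => f z.1) (openStrip T) :=
    fun hf => (hf.comp continuous_fst).continuousOn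
  exact ((((hc''.comp_continuousOn h1).mul (((h3.mul h1).mul h2).sub (h2.pow 2))).mul
    (hf (continuous_cutoff R))).add (((h3.mul h1).mul (hc'.comp_continuousOn h1)).mul
    (hf (continuous_cutoffDeriv R)))).add ((hc.comp_continuousOn h1).mul
    (hf (continuous_cutoffDeriv2 R)))

/-- With φ the cutoff, the integrands differ by the x-derivative of η'(u) φ (u_x - bu) - η(u) φ',
which vanishes at ±R because φ and φ' do. -/
theorem integral_mul_timeDeriv (hb : IsAdvectionField b) (hu : IsSolution b p₀ T u)
    {η η' η'' : ℝ → ℝ} (hη : ∀ s, HasDerivAt η (η' s) s) (hη' : ∀ s, HasDerivAt η' (η'' s) s)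
    (hc'' : Continuous η'') {R : ℝ} (hR : 0 < R) {t : ℝ} (ht : t ∈ openTimes T) :
    ∫ x in (-R)..R, η' (u x t) * timeDeriv u x t * cutoff R x =
      ∫ x in (-R)..R, entropyProduction b u η η' η'' R x t := by
  have hc : Continuous η := continuous_iff_continuousAt.2 fun s => (hη s).continuousAt
  have hc' : Continuous η' := continuous_iff_continuousAt.2 fun s => (hη' s).continuousAt
  have h1 := continuous_slice hu.continuousOn ht
  have h2 := continuous_slice hu.continuousOn_space ht
  have h3 := continuous_slice (hb.continuousOn_strip T) ht
  have h4 := continuous_slice hu.continuousOn_time ht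
  have h5 := continuous_slice (continuousOn_entropyProduction hb hu hc hc' hc'' R) ht
  have hP : ∀ x, HasDerivAt (fun x => η' (u x t) * cutoff R x *
      (spaceDeriv u x t - b x t * u x t) - η (u x t) * cutoffDeriv R x)
      (η' (u x t) * timeDeriv u x t * cutoff R x - entropyProduction b u η η' η'' R x t) x := by
    intro x
    have hux := hu.hasDerivAt_space x ht
    refine (((((hη' (u x t)).comp x hux).mul (hasDerivAt_cutoff R x)).mul
      (hu.hasDerivAt_flux hb x ht)).sub
      (((hη (u x t)).comp x hux).mul (hasDerivAt_cutoffDeriv R x))).congr_deriv ?_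
    simp only [entropyProduction, Function.comp, Pi.mul_apply]
    ring
  have h6 : Continuous fun x => η' (u x t) * timeDeriv u x t * cutoff R x :=
    ((hc'.comp h1).mul h4).mul (continuous_cutoff R)
  have hint := intervalIntegral.integral_eq_sub_of_hasDerivAt (a := -R) (b := R)
    (fun x _ => hP x) ((h6.sub h5).intervalIntegrable _ _)
  rw [intervalIntegral.integral_sub (h6.intervalIntegrable _ _) (h5.intervalIntegrable _ _),
    cutoff_right hR, cutoff_left hR, cutoffDeriv_right hR, cutoffDeriv_left hR] at hint
  simp only [mul_zero, zero_mul, sub_zero] at hint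
  linarith

/-- Local entropy balance for solutions. -/
theorem hasDerivAt_integral_entropy (hb : IsAdvectionField b) (hu : IsSolution b p₀ T u)
    {η η' η'' : ℝ → ℝ} (hη : ∀ s, HasDerivAt η (η' s) s) (hη' : ∀ s, HasDerivAt η' (η'' s) s)
    (hc'' : Continuous η'') {R : ℝ} (hR : 0 < R) {t : ℝ} (ht : t ∈ openTimes T) :
    HasDerivAt (fun t => ∫ x in (-R)..R, η (u x t) * cutoff R x)
      (∫ x in (-R)..R, entropyProduction b u η η' η'' R x t) t := by
  have hc : Continuous η := continuous_iff_continuousAt.2 fun s => (hη s).continuousAt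
  have hc' : Continuous η' := continuous_iff_continuousAt.2 fun s => (hη' s).continuousAt
  rw [← integral_mul_timeDeriv hb hu hη hη' hc'' hR ht]
  obtain ⟨ε, hε, hball⟩ := Metric.nhds_basis_closedBall.mem_iff.1
    ((isOpen_openTimes T).mem_nhds ht)
  have hcont : ContinuousOn (fun z : ℝ × ℝ => η' (u z.1 z.2) * timeDeriv u z.1 z.2 * cutoff R z.1)
      (openStrip T) :=
    ((hc'.comp_continuousOn hu.continuousOn).mul hu.continuousOn_time).mul
      ((continuous_cutoff R).comp continuous_fst).continuousOn
  obtain ⟨C, hC⟩ := (isCompact_uIcc (a := -R) (b := R)).prod (isCompact_closedBall t ε)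
    |>.exists_bound_of_continuousOn
      (hcont.mono fun z hz => hball hz.2)
  have hsl : ∀ {τ}, τ ∈ openTimes T → Continuous fun x => η (u x τ) * cutoff R x := fun hτ =>
    (hc.comp (continuous_slice hu.continuousOn hτ)).mul (continuous_cutoff R)
  refine (intervalIntegral.hasDerivAt_integral_of_dominated_loc_of_deriv_le
    (F := fun τ x => η (u x τ) * cutoff R x)
    (F' := fun τ x => η' (u x τ) * timeDeriv u x τ * cutoff R x)
    (bound := fun _ => C) (Metric.closedBall_mem_nhds t hε) ?_ ((hsl ht).intervalIntegrable _ _)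
    ?_ ?_ ?_ ?_).2
  · filter_upwards [(isOpen_openTimes T).mem_nhds ht] with τ hτ
      using (hsl hτ).aestronglyMeasurable
  · exact (continuous_slice (f := fun x t => η' (u x t) * timeDeriv u x t * cutoff R x) hcont
      ht).aestronglyMeasurable
  · exact ae_of_all _ fun x hx τ hτ => hC (x, τ) ⟨uIoc_subset_uIcc hx, hτ⟩
  · exact intervalIntegrable_const
  · exact ae_of_all _ fun x _ τ hτ =>
      ((hη _).comp τ (hu.hasDerivAt_time x (hball hτ))).mul_const _

end Solution

/-! ### Gronwall's inequality and regularized powers. -/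

/-- Gronwall's inequality for a scalar differential inequality. -/
theorem le_exp_mul_of_deriv_le {F F' : ℝ → ℝ} {c K r s : ℝ} (hrs : r ≤ s)
    (hF : ∀ t ∈ Icc r s, HasDerivAt F (F' t) t) (hle : ∀ t ∈ Icc r s, F' t ≤ c * (F t + K)) :
    F s + K ≤ Real.exp (c * (s - r)) * (F r + K) := by
  have hG : ∀ t ∈ Icc r s, HasDerivAt (fun t => Real.exp (-(c * t)) * (F t + K))
      (Real.exp (-(c * t)) * (F' t - c * (F t + K))) t := by
    intro t ht
    have h1 : HasDerivAt (fun t => Real.exp (-(c * t))) (Real.exp (-(c * t)) * (-(c * 1))) t :=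
      ((((hasDerivAt_id t).const_mul c).neg)).exp
    exact (h1.mul ((hF t ht).add_const K)).congr_deriv (by ring)
  have hanti : AntitoneOn (fun t => Real.exp (-(c * t)) * (F t + K)) (Icc r s) := by
    refine antitoneOn_of_deriv_nonpos (convex_Icc r s)
      (fun t ht => (hG t ht).continuousAt.continuousWithinAt)
      (fun t ht => (hG t (interior_subset ht)).differentiableAt.differentiableWithinAt)
      fun t ht => ?_
    rw [(hG t (interior_subset ht)).deriv]
    exact mul_nonpos_of_nonneg_of_nonpos (Real.exp_nonneg _)
      (by linarith [hle t (interior_subset ht)])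
  have h := hanti ⟨le_rfl, hrs⟩ ⟨hrs, le_rfl⟩ hrs
  simp only at h
  have h2 := mul_le_mul_of_nonneg_left h (Real.exp_nonneg (c * s))
  rw [← mul_assoc, ← mul_assoc, ← Real.exp_add, ← Real.exp_add, add_neg_cancel, Real.exp_zero,
    one_mul, ← sub_eq_add_neg, ← mul_sub] at h2
  exact h2

/-- The smooth approximation `(s² + δ²)^(p/2)` of `|s|^p`. -/
noncomputable def regPow (p δ s : ℝ) : ℝ := (s ^ 2 + δ ^ 2) ^ (p / 2)

/-- First derivative of `regPow`. -/
noncomputable def regPowDeriv (p δ s : ℝ) : ℝ := p * s * (s ^ 2 + δ ^ 2) ^ (p / 2 - 1)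

/-- Second derivative of `regPow`. -/
noncomputable def regPowDeriv2 (p δ s : ℝ) : ℝ :=
  p * (s ^ 2 + δ ^ 2) ^ (p / 2 - 1) + p * (p - 2) * s ^ 2 * (s ^ 2 + δ ^ 2) ^ (p / 2 - 1 - 1)

section RegPow

variable {p δ : ℝ}

theorem hasDerivAt_regPow_aux (hδ : 0 < δ) (r s : ℝ) :
    HasDerivAt (fun s => (s ^ 2 + δ ^ 2) ^ r) (2 * r * s * (s ^ 2 + δ ^ 2) ^ (r - 1)) s := by
  have h : HasDerivAt (fun s : ℝ => s ^ 2 + δ ^ 2) (2 * s) s := by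
    simpa using ((hasDerivAt_id s).pow 2).add_const (δ ^ 2)
  refine (h.rpow_const (p := r) (Or.inl (by positivity))).congr_deriv ?_
  ring

theorem hasDerivAt_regPow (hδ : 0 < δ) (s : ℝ) :
    HasDerivAt (regPow p δ) (regPowDeriv p δ s) s := by
  refine (hasDerivAt_regPow_aux hδ (p / 2) s).congr_deriv ?_
  unfold regPowDeriv; ring

theorem hasDerivAt_regPowDeriv (hδ : 0 < δ) (s : ℝ) :
    HasDerivAt (regPowDeriv p δ) (regPowDeriv2 p δ s) s := by
  refine (((hasDerivAt_id s).const_mul p).mul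
    (hasDerivAt_regPow_aux hδ (p / 2 - 1) s)).congr_deriv ?_
  simp only [regPowDeriv2, id]; ring

theorem continuous_regPowDeriv2 (hδ : 0 < δ) : Continuous (regPowDeriv2 p δ) := by
  have h : ∀ r : ℝ, Continuous fun s : ℝ => (s ^ 2 + δ ^ 2) ^ r := fun r =>
    Continuous.rpow_const (by fun_prop) fun s => Or.inl (by positivity)
  exact (continuous_const.mul (h _)).add ((by fun_prop : Continuous fun s : ℝ =>
    p * (p - 2) * s ^ 2).mul (h _))

theorem regPow_nonneg (s : ℝ) : 0 ≤ regPow p δ s := by unfold regPow; positivity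

theorem rpow_sub_one_mul_self {E : ℝ} (hE : 0 < E) (r : ℝ) : E ^ (r - 1) * E = E ^ r := by
  rw [← Real.rpow_add_one hE.ne', sub_add_cancel]

/-- Factoring out (s² + δ²)^(p/2-2) leaves p(δ² + (p-1)s²). This convexity gives the diffusion term
its sign. -/
theorem regPowDeriv2_nonneg (hp : 1 ≤ p) (hδ : 0 < δ) (s : ℝ) : 0 ≤ regPowDeriv2 p δ s := by
  have hE : 0 < s ^ 2 + δ ^ 2 := by positivity
  unfold regPowDeriv2
  rw [← rpow_sub_one_mul_self hE (p / 2 - 1)]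
  have : 0 ≤ (s ^ 2 + δ ^ 2) ^ (p / 2 - 1 - 1) * (p * (δ ^ 2 + (p - 1) * s ^ 2)) := by
    have : 0 ≤ p - 1 := by linarith
    positivity
  linarith

/-- A δ-independent form of the homogeneity of |s|^p; it lets the advection term be absorbed by
Gronwall. -/
theorem regPowDeriv2_mul_sq_le (hp : 1 ≤ p) (hδ : 0 < δ) (s : ℝ) :
    regPowDeriv2 p δ s * s ^ 2 ≤ p ^ 2 * regPow p δ s := by
  have hE : 0 < s ^ 2 + δ ^ 2 := by positivity
  unfold regPowDeriv2 regPow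
  rw [← rpow_sub_one_mul_self hE (p / 2), ← rpow_sub_one_mul_self hE (p / 2 - 1)]
  have hle : (p * (δ ^ 2 + (p - 1) * s ^ 2)) * s ^ 2 ≤ p ^ 2 * (s ^ 2 + δ ^ 2) ^ 2 := by
    have h1 : δ ^ 2 + (p - 1) * s ^ 2 ≤ p * (s ^ 2 + δ ^ 2) := by
      nlinarith [sq_nonneg s, sq_nonneg δ]
    have h2 : s ^ 2 ≤ s ^ 2 + δ ^ 2 := by nlinarith
    have h3 := mul_le_mul h1 h2 (sq_nonneg s) (by positivity)
    nlinarith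
  have := mul_le_mul_of_nonneg_left hle
    (Real.rpow_nonneg hE.le (p / 2 - 1 - 1))
  linarith

theorem abs_mul_regPowDeriv_le (hp : 1 ≤ p) (hδ : 0 < δ) (s : ℝ) :
    |s * regPowDeriv p δ s| ≤ p * regPow p δ s := by
  have hE : 0 < s ^ 2 + δ ^ 2 := by positivity
  unfold regPowDeriv regPow
  have e : s * (p * s * (s ^ 2 + δ ^ 2) ^ (p / 2 - 1)) =
    p * (s ^ 2 + δ ^ 2) ^ (p / 2 - 1) * s ^ 2 := by ring
  rw [e, abs_of_nonneg (by positivity), ← rpow_sub_one_mul_self hE (p / 2), ← mul_assoc]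
  gcongr
  nlinarith

theorem abs_rpow_le_regPow (hp : 1 ≤ p) (s : ℝ) : |s| ^ p ≤ regPow p δ s := by
  have : |s| ^ p = (s ^ 2) ^ (p / 2) := by
    rw [← sq_abs, ← Real.rpow_natCast, ← Real.rpow_mul (abs_nonneg s)]
    congr 1; push_cast; ring
  rw [this]
  exact Real.rpow_le_rpow (sq_nonneg s) (by nlinarith [sq_nonneg δ]) (by linarith)

theorem regPow_le (hp : 1 ≤ p) (hδ : 0 < δ) (s : ℝ) :
    regPow p δ s ≤ 2 ^ p * (|s| ^ p + δ ^ p) := by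
  have h1 : regPow p δ s ≤ (2 * max |s| δ) ^ p := by
    have e : (2 * max |s| δ) ^ p = ((2 * max |s| δ) ^ 2) ^ (p / 2) := by
      rw [← Real.rpow_natCast, ← Real.rpow_mul (by positivity)]
      congr 1; push_cast; ring
    rw [e]
    refine Real.rpow_le_rpow (by positivity) ?_ (by linarith)
    have h2 : |s| ^ 2 ≤ max |s| δ ^ 2 := by gcongr; exact le_max_left _ _
    have h3 : δ ^ 2 ≤ max |s| δ ^ 2 := by gcongr; exact le_max_right _ _
    rw [sq_abs] at h2
    nlinarith
  rw [Real.mul_rpow (by norm_num) (by positivity)] at h1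
  refine h1.trans (mul_le_mul_of_nonneg_left ?_ (by positivity))
  rcases max_cases |s| δ with ⟨h, -⟩ | ⟨h, -⟩ <;> rw [h]
  · linarith [Real.rpow_nonneg hδ.le p]
  · linarith [Real.rpow_nonneg (abs_nonneg s) p]

theorem regPow_le_of_abs_le (hp : 1 ≤ p) (hδ1 : δ ≤ 1) (hδ : 0 < δ) {s M : ℝ} (hs : |s| ≤ M) :
    regPow p δ s ≤ (M ^ 2 + 1) ^ (p / 2) := by
  refine Real.rpow_le_rpow (by positivity) ?_ (by linarith)
  have := sq_le_sq' (abs_le.1 hs).1 (abs_le.1 hs).2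
  nlinarith

end RegPow

/-! ### Propagation of L^p integrability from the initial value. -/

section Solution

variable {b u : ℝ → ℝ → ℝ} {p₀ : ℝ} {T : EReal}

/-- At positive times a bound on a dense set extends everywhere by continuity in x; at t = 0 it
remains almost everywhere. -/
theorem IsSolution.exists_bound (hu : IsSolution b p₀ T u) {S : ℝ} (hS : (S : EReal) < T) :
    ∃ M : ℝ, 0 ≤ M ∧ (∀ t : ℝ, 0 ≤ t → t ≤ S → ∀ᵐ x ∂volume, |u x t| ≤ M) ∧
      ∀ t : ℝ, 0 < t → t ≤ S → ∀ x, |u x t| ≤ M := by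
  obtain ⟨M, hM⟩ := hu.bounded S hS
  have hM' : ∀ t : ℝ, 0 ≤ t → t ≤ S → ∀ᵐ x ∂volume, |u x t| ≤ max M 0 := fun t h0 h1 =>
    (hM t h0 h1).mono fun x hx => hx.trans (le_max_left _ _)
  refine ⟨max M 0, le_max_right _ _, hM', fun t h0 h1 x => ?_⟩
  have hc : Continuous fun x => |u x t| :=
    (continuous_slice hu.continuousOn ⟨h0, (EReal.coe_le_coe_iff.2 h1).trans_lt hS⟩).abs
  have hd := Measure.dense_of_ae (hM' t h0.le h1)
  have hcl : IsClosed {x | |u x t| ≤ max M 0} := isClosed_le hc continuous_const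
  have := hd.closure_eq
  rw [hcl.closure_eq] at this
  exact (Set.ext_iff.1 this x).2 (mem_univ x)

theorem IsAdvectionField.exists_bound {b : ℝ → ℝ → ℝ} (hb : IsAdvectionField b) :
    ∃ M : ℝ, 0 ≤ M ∧ ∀ x t : ℝ, 0 ≤ t → |b x t| ≤ M := by
  obtain ⟨M, hM⟩ := hb.bounded
  exact ⟨M, (abs_nonneg _).trans (hM 0 0 le_rfl), hM⟩

theorem IsSolution.aestronglyMeasurable (hu : IsSolution b p₀ T u) {t : ℝ} (ht : 0 ≤ t)
    (htT : (t : EReal) < T) : AEStronglyMeasurable (fun x => u x t) volume := by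
  rcases ht.eq_or_lt with rfl | ht
  · exact hu.initial_memLp.1
  · exact (continuous_slice hu.continuousOn ⟨ht, htT⟩).aestronglyMeasurable

theorem IsSolution.intervalIntegrable_comp (hu : IsSolution b p₀ T u) {η : ℝ → ℝ}
    (hη : Continuous η) (R : ℝ) {t : ℝ} (ht : 0 ≤ t)
    (htT : (t : EReal) < T) (r s : ℝ) :
    IntervalIntegrable (fun x => η (u x t) * cutoff R x) volume r s := by
  obtain ⟨M, hM0, hM, -⟩ := hu.exists_bound htT
  obtain ⟨C, hC⟩ := (isCompact_Icc (a := -M) (b := M)).exists_bound_of_continuousOn hη.continuousOn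
  have h1 : IntervalIntegrable (fun x => η (u x t)) volume r s := by
    rw [intervalIntegrable_iff]
    refine Measure.integrableOn_of_bounded (M := C) (by simp [uIoc]) ?_ ?_
    · exact hη.comp_aestronglyMeasurable (hu.aestronglyMeasurable ht htT)
    · filter_upwards [ae_restrict_of_ae (hM t ht le_rfl)] with x hx using hC _ (abs_le.1 hx)
  exact h1.mul_continuousOn (continuous_cutoff R).continuousOn

/-- Local entropies attain their initial values. -/
theorem IsSolution.tendsto_integral_entropy (hT : 0 < T) (hu : IsSolution b p₀ T u) {η η' : ℝ → ℝ}
    (hη : ∀ s, HasDerivAt η (η' s) s) (hη' : Continuous η') {R : ℝ} (hR : 0 < R) :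
    Tendsto (fun t => ∫ x in (-R)..R, η (u x t) * cutoff R x) (𝓝[>] 0)
      (𝓝 (∫ x in (-R)..R, η (u x 0) * cutoff R x)) := by
  have hc : Continuous η := continuous_iff_continuousAt.2 fun s => (hη s).continuousAt
  obtain ⟨S, hS0, hST⟩ := EReal.lt_iff_exists_real_btwn.1 hT
  have hS0' : 0 < S := by exact_mod_cast hS0
  obtain ⟨M, hM0, hM, -⟩ := hu.exists_bound hST
  obtain ⟨L, hL⟩ := (isCompact_Icc (a := -M) (b := M)).exists_bound_of_continuousOn
    hη'.continuousOn
  -- Since u is bounded, η is Lipschitz on its range and L¹_loc convergence of u passes to η(u).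
  have hLip : ∀ y ∈ Icc (-M) M, ∀ z ∈ Icc (-M) M, |η y - η z| ≤ L * |y - z| := fun y hy z hz =>
    (convex_Icc (-M) M).norm_image_sub_le_of_norm_hasDerivWithin_le
      (fun s _ => (hη s).hasDerivWithinAt) hL hz hy
  rw [tendsto_iff_norm_sub_tendsto_zero]
  have hlim := (hu.initial_tendsto (Icc (-R) R) isCompact_Icc).const_mul L
  rw [mul_zero] at hlim
  refine squeeze_zero' (Eventually.of_forall fun t => norm_nonneg _) ?_ hlim
  filter_upwards [Ioc_mem_nhdsGT hS0'] with t ht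
  have htT : (t : EReal) < T := (EReal.coe_le_coe_iff.2 ht.2).trans_lt hST
  rw [← intervalIntegral.integral_sub (hu.intervalIntegrable_comp hc R ht.1.le htT _ _)
    (hu.intervalIntegrable_comp hc R le_rfl hT _ _), ← integral_const_mul,
    integral_Icc_eq_integral_Ioc, ← intervalIntegral.integral_of_le (by linarith)]
  refine intervalIntegral.norm_integral_le_of_norm_le (by linarith) ?_ ?_
  · filter_upwards [hM t ht.1.le ht.2, hM 0 le_rfl hS0'.le] with x hx hx0 hxR
    rw [← sub_mul, Real.norm_eq_abs, abs_mul, abs_of_nonneg (cutoff_nonneg R x)]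
    have h1 := hLip _ (abs_le.1 hx) _ (abs_le.1 hx0)
    have h2 := cutoff_le_one hR ⟨hxR.1.le, hxR.2⟩
    calc _ ≤ |η (u x t) - η (u x 0)| * 1 := by gcongr
      _ ≤ _ := by linarith
  · rw [intervalIntegrable_iff]
    refine Measure.integrableOn_of_bounded (M := |L| * (2 * M)) (by simp [uIoc]) ?_ ?_
    · exact (((hu.aestronglyMeasurable ht.1.le htT).sub
        (hu.aestronglyMeasurable le_rfl hT)).norm).const_mul L
    · filter_upwards [ae_restrict_of_ae (hM t ht.1.le ht.2),
        ae_restrict_of_ae (hM 0 le_rfl hS0'.le)] with x hx hx0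
      rw [Real.norm_eq_abs, abs_mul, abs_abs]
      gcongr
      exact (abs_sub _ _).trans (by linarith)

/-- Completing the square, b u u_x - u_x² ≤ b²u²/4, removes the gradient by convexity. The terms
with derivatives of the cutoff are O(1/R) because u is bounded. -/
theorem entropyProduction_regPow_le {p δ : ℝ} (hp : 1 ≤ p) (hδ : 0 < δ) (hδ1 : δ ≤ 1)
    {x t R M Mb : ℝ} (hM : |u x t| ≤ M) (hMb : |b x t| ≤ Mb) (hR : 1 ≤ R)
    (hx : x ∈ Icc (-R) R) :
    entropyProduction b u (regPow p δ) (regPowDeriv p δ) (regPowDeriv2 p δ) R x t ≤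
      p ^ 2 * Mb ^ 2 / 4 * (regPow p δ (u x t) * cutoff R x) +
        (M ^ 2 + 1) ^ (p / 2) * (8 + 4 * (p * Mb)) / R := by
  have hR0 : 0 < R := by linarith
  have hMb0 : 0 ≤ Mb := (abs_nonneg _).trans hMb
  set s := u x t
  have h0 := regPow_nonneg (p := p) (δ := δ) s
  have h1 : regPowDeriv2 p δ s * (b x t * s * spaceDeriv u x t - spaceDeriv u x t ^ 2) ≤
      p ^ 2 * Mb ^ 2 / 4 * regPow p δ s := by
    have h2 := regPowDeriv2_nonneg hp hδ s
    have h3 := regPowDeriv2_mul_sq_le hp hδ s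
    have h4 : b x t ^ 2 ≤ Mb ^ 2 := sq_le_sq' (abs_le.1 hMb).1 (abs_le.1 hMb).2
    calc _ ≤ regPowDeriv2 p δ s * (b x t ^ 2 * s ^ 2 / 4) := by
          gcongr
          nlinarith [sq_nonneg (b x t * s - 2 * spaceDeriv u x t)]
      _ = b x t ^ 2 / 4 * (regPowDeriv2 p δ s * s ^ 2) := by ring
      _ ≤ Mb ^ 2 / 4 * (p ^ 2 * regPow p δ s) := by gcongr
      _ = _ := by ring
  have h2 := mul_le_mul_of_nonneg_right h1 (cutoff_nonneg R x)
  have hK := regPow_le_of_abs_le hp hδ1 hδ hM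
  have h3 : b x t * s * regPowDeriv p δ s * cutoffDeriv R x ≤
      Mb * (p * (M ^ 2 + 1) ^ (p / 2)) * (4 / R) := by
    refine (le_abs_self _).trans ?_
    rw [abs_mul, mul_assoc (b x t), abs_mul]
    gcongr
    · exact (abs_mul_regPowDeriv_le hp hδ s).trans (by gcongr)
    · exact abs_cutoffDeriv_le hR hx
  have h4 : regPow p δ s * cutoffDeriv2 R x ≤ (M ^ 2 + 1) ^ (p / 2) * (8 / R) := by
    refine (le_abs_self _).trans ?_
    rw [abs_mul, abs_of_nonneg h0]
    gcongr
    exact abs_cutoffDeriv2_le hR hx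
  unfold entropyProduction
  calc _ ≤ p ^ 2 * Mb ^ 2 / 4 * regPow p δ s * cutoff R x +
        Mb * (p * (M ^ 2 + 1) ^ (p / 2)) * (4 / R) + (M ^ 2 + 1) ^ (p / 2) * (8 / R) := by
        linarith
    _ = _ := by ring

/-- Localized and regularized `L^p` bound, uniform in the cutoff and the regularization. -/
theorem exists_integral_regPow_le (hb : IsAdvectionField b) (hT : 0 < T)
    (hu : IsSolution b p₀ T u) {p : ℝ} (hp : 1 ≤ p) {S : ℝ} (hS : (S : EReal) < T) :
    ∃ C K : ℝ, 0 ≤ C ∧ ∀ δ R t : ℝ, 0 < δ → δ ≤ 1 → 1 ≤ R → 0 < t → t ≤ S →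
      ∫ x in (-R)..R, regPow p δ (u x t) * cutoff R x ≤
        C * ((∫ x in (-R)..R, regPow p δ (u x 0) * cutoff R x) + K) := by
  obtain ⟨M, hM0, -, hM⟩ := hu.exists_bound hS
  obtain ⟨Mb, hMb0, hMb⟩ := hb.exists_bound
  -- The added 1 keeps c positive when the bound on b is 0, so that K/c is meaningful.
  set c := p ^ 2 * Mb ^ 2 / 4 + 1 with hc
  have hc0 : 0 < c := by positivity
  -- The pointwise error O(1/R) integrated over length 2R: a constant independent of R and δ.
  set K := 2 * ((M ^ 2 + 1) ^ (p / 2) * (8 + 4 * (p * Mb))) with hK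
  have hK0 : 0 ≤ K := by positivity
  refine ⟨Real.exp (c * S), K / c, Real.exp_nonneg _, fun δ R t hδ hδ1 hR ht htS => ?_⟩
  have hR0 : 0 < R := by linarith
  have hSt : ∀ {τ}, 0 < τ → τ ≤ t → τ ∈ openTimes T := fun h1 h2 =>
    ⟨h1, (EReal.coe_le_coe_iff.2 (h2.trans htS)).trans_lt hS⟩
  set F : ℝ → ℝ := fun t => ∫ x in (-R)..R, regPow p δ (u x t) * cutoff R x with hF
  have hcη : Continuous (regPow p δ) :=
    continuous_iff_continuousAt.2 fun s => (hasDerivAt_regPow hδ s).continuousAt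
  have hcη' : Continuous (regPowDeriv p δ) :=
    continuous_iff_continuousAt.2 fun s => (hasDerivAt_regPowDeriv hδ s).continuousAt
  have hFnn : ∀ t, 0 ≤ F t := fun t => intervalIntegral.integral_nonneg (by linarith)
    fun x _ => mul_nonneg (regPow_nonneg _) (cutoff_nonneg _ _)
  have hle : ∀ τ, 0 < τ → τ ≤ t → ∫ x in (-R)..R,
      entropyProduction b u (regPow p δ) (regPowDeriv p δ) (regPowDeriv2 p δ) R x τ ≤
        c * (F τ + K / c) := by
    intro τ h1 h2
    have hτ := hSt h1 h2
    have hi := hu.intervalIntegrable_comp hcη R h1.le hτ.2 (-R) R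
    have := intervalIntegral.integral_mono_on (by linarith : -R ≤ R)
      ((continuous_slice (continuousOn_entropyProduction hb hu hcη hcη'
        (continuous_regPowDeriv2 hδ) R) hτ).intervalIntegrable _ _)
      ((hi.const_mul (p ^ 2 * Mb ^ 2 / 4)).add intervalIntegrable_const) fun x hx =>
        entropyProduction_regPow_le hp hδ hδ1 (hM τ h1 (h2.trans htS) x) (hMb x τ h1.le) hR hx
    rw [intervalIntegral.integral_add (hi.const_mul _) intervalIntegrable_const,
      intervalIntegral.integral_const_mul, intervalIntegral.integral_const, smul_eq_mul] at this
    refine this.trans ?_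
    have e : (R - -R) * ((M ^ 2 + 1) ^ (p / 2) * (8 + 4 * (p * Mb)) / R) = K := by
      rw [hK]; field_simp; ring
    rw [e, mul_add, mul_div_cancel₀ _ hc0.ne']
    have := hFnn τ
    change _ * F τ + K ≤ _
    rw [hc]
    linarith
  have hgr : ∀ r, 0 < r → r ≤ t → F t ≤ Real.exp (c * S) * (F r + K / c) := by
    intro r hr hrt
    have := le_exp_mul_of_deriv_le hrt (F := F) (fun τ hτ => hasDerivAt_integral_entropy hb hu
      (hasDerivAt_regPow hδ) (hasDerivAt_regPowDeriv hδ) (continuous_regPowDeriv2 hδ) hR0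
      (hSt (hr.trans_le hτ.1) hτ.2)) fun τ hτ => hle τ (hr.trans_le hτ.1) hτ.2
    have hKc : 0 ≤ K / c := by positivity
    have h2 : Real.exp (c * (t - r)) ≤ Real.exp (c * S) := by gcongr; linarith
    have h3 := mul_le_mul_of_nonneg_right h2 (add_nonneg (hFnn r) hKc)
    linarith
  -- The starting time r tends to 0, where the equation itself is not available.
  have hlim := ((hu.tendsto_integral_entropy hT (hasDerivAt_regPow (p := p) hδ) hcη'
    hR0).add_const (K / c)).const_mul (Real.exp (c * S))
  refine ge_of_tendsto hlim ?_
  filter_upwards [Ioc_mem_nhdsGT ht] with r hr using hgr r hr.1 hr.2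

theorem IsSolution.integrable_initial (hT : 0 < T) (hu : IsSolution b p₀ T u) (hp₀ : 1 ≤ p₀)
    {p : ℝ} (hp : p₀ ≤ p) : Integrable fun x => |u x 0| ^ p := by
  obtain ⟨M, hM0, hM, -⟩ := hu.exists_bound (S := 0) (by exact_mod_cast hT)
  have h1 : Integrable fun x => |u x 0| ^ p₀ := by
    have := hu.initial_memLp.integrable_norm_rpow (by simp; linarith) (by simp)
    simpa [ENNReal.toReal_ofReal (by linarith : 0 ≤ p₀)] using this
  refine (h1.const_mul (M ^ (p - p₀))).mono' ?_ ?_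
  · exact ((continuous_abs.rpow_const fun _ => Or.inr (by linarith)).comp_aestronglyMeasurable
      hu.initial_memLp.1)
  · filter_upwards [hM 0 le_rfl le_rfl] with x hx
    rw [Real.norm_eq_abs, abs_of_nonneg (by positivity)]
    have : |u x 0| ^ p = |u x 0| ^ (p - p₀) * |u x 0| ^ p₀ := by
      rw [← Real.rpow_add_of_nonneg (abs_nonneg _) (by linarith) (by linarith), sub_add_cancel]
    rw [this]
    gcongr

/-- Solutions stay in `L^p`, locally uniformly in time, for `p ≥ p₀`. -/
theorem exists_integral_abs_rpow_le (hb : IsAdvectionField b) (hT : 0 < T)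
    (hu : IsSolution b p₀ T u) (hp₀ : 1 ≤ p₀) {p : ℝ} (hp : p₀ ≤ p) {S : ℝ}
    (hS : (S : EReal) < T) :
    ∃ C : ℝ, ∀ t : ℝ, 0 ≤ t → t ≤ S →
      Integrable (fun x => |u x t| ^ p) ∧ ∫ x, |u x t| ^ p ≤ C := by
  have hp1 : 1 ≤ p := hp₀.trans hp
  have h0 := hu.integrable_initial hT hp₀ hp
  obtain ⟨C, K, hC, hCK⟩ := exists_integral_regPow_le hb hT hu hp1 hS
  set A := ∫ x, |u x 0| ^ p
  set C' := 16 / 9 * (C * (2 ^ p * (A + 1) + K))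
  refine ⟨max A C', fun t ht htS => ?_⟩
  rcases ht.eq_or_lt with rfl | ht
  · exact ⟨h0, le_max_left _ _⟩
  have htT : t ∈ openTimes T := ⟨ht, (EReal.coe_le_coe_iff.2 htS).trans_lt hS⟩
  have hc : Continuous fun x => |u x t| ^ p :=
    (continuous_slice hu.continuousOn htT).abs.rpow_const fun _ => Or.inr (by linarith)
  have key : ∀ n : ℝ, 1 ≤ n → ∫ x in (-n)..n, |u x t| ^ p ≤ C' := by
    intro n hn
    -- The cutoff is at least 9/16 on [-n, n], and δ is small enough that 2R δ^p ≤ 1: the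
    -- regularization adds bounded mass.
    set R := 2 * n with hR
    set δ := 1 / (2 * R) with hδ
    have hR1 : 1 ≤ R := by linarith
    have hR0 : 0 < R := by linarith
    have hδ0 : 0 < δ := by positivity
    have hδ1 : δ ≤ 1 := by rw [hδ, div_le_one (by positivity)]; linarith
    have hcη : Continuous (regPow p δ) :=
      continuous_iff_continuousAt.2 fun s => (hasDerivAt_regPow hδ0 s).continuousAt
    have h1 : ∫ x in (-R)..R, regPow p δ (u x 0) * cutoff R x ≤ 2 ^ p * (A + 1) := by
      have hg : Integrable (fun x => |u x 0| ^ p) := h0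
      have h2 := intervalIntegral.integral_mono_on (by linarith : -R ≤ R)
        (hu.intervalIntegrable_comp hcη R le_rfl hT _ _)
        ((hg.intervalIntegrable.add (intervalIntegrable_const (c := δ ^ p))).const_mul (2 ^ p))
        fun x hx => (mul_le_of_le_one_right (regPow_nonneg _) (cutoff_le_one hR0 hx)).trans
          (regPow_le hp1 hδ0 _)
      refine h2.trans ?_
      rw [intervalIntegral.integral_const_mul, intervalIntegral.integral_add
        hg.intervalIntegrable intervalIntegrable_const, intervalIntegral.integral_const,
        smul_eq_mul]
      gcongr
      · rw [intervalIntegral.integral_of_le (by linarith)]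
        exact setIntegral_le_integral hg (ae_of_all _ fun x => by positivity)
      · have : δ ^ p ≤ δ := by
          simpa using Real.rpow_le_rpow_of_exponent_ge hδ0 hδ1 hp1
        calc (R - -R) * δ ^ p ≤ (R - -R) * δ := by gcongr; linarith
          _ = 1 := by rw [hδ]; field_simp; ring
    have h2 := hCK δ R t hδ0 hδ1 hR1 ht htS
    have hi := hu.intervalIntegrable_comp hcη R ht.le htT.2
    have h3 : ∫ x in (-n)..n, 9 / 16 * |u x t| ^ p ≤
        ∫ x in (-R)..R, regPow p δ (u x t) * cutoff R x := by
      refine (intervalIntegral.integral_mono_on (by linarith)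
        ((hc.intervalIntegrable _ _).const_mul _) (hi (-n) n) fun x hx => ?_).trans
        (intervalIntegral.integral_mono_interval (by linarith) (by linarith) (by linarith)
          (ae_of_all _ fun x => mul_nonneg (regPow_nonneg _) (cutoff_nonneg _ _)) (hi _ _))
      have h4 : 9 / 16 ≤ cutoff R x := le_cutoff hR0 (by rw [hR]; simpa using hx)
      have h5 := abs_rpow_le_regPow (δ := δ) hp1 (u x t)
      have h6 : 0 ≤ |u x t| ^ p := by positivity
      rw [mul_comm]
      exact mul_le_mul h5 h4 (by norm_num) (regPow_nonneg _)
    rw [intervalIntegral.integral_const_mul] at h3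
    have h7 := mul_le_mul_of_nonneg_left (add_le_add_left h1 K) hC
    simp only [C']
    linarith
  have hint : Integrable fun x => |u x t| ^ p := by
    refine integrable_of_intervalIntegral_norm_bounded C' (a := fun n : ℝ => -n) (b := id)
      (l := atTop) (fun n => (hc.intervalIntegrable _ _).1) tendsto_neg_atTop_atBot tendsto_id ?_
    filter_upwards [eventually_ge_atTop 1] with n hn
    refine le_trans (le_of_eq ?_) (key n hn)
    refine intervalIntegral.integral_congr fun x _ => ?_
    simp only [Real.norm_eq_abs]
    exact abs_of_nonneg (by positivity)
  refine ⟨hint, le_trans ?_ (le_max_right _ _)⟩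
  refine le_of_tendsto (intervalIntegral_tendsto_integral hint tendsto_neg_atTop_atBot tendsto_id)
    ?_
  filter_upwards [eventually_ge_atTop 1] with n hn using key n hn

end Solution

/-! ### The energy balance for |s|^q on time slabs. -/

theorem hasDerivAt_abs_rpow_sub_two_mul {q : ℝ} (hq : 2 ≤ q) (s : ℝ) :
    HasDerivAt (fun s => q * (|s| ^ (q - 2) * s)) (q * (q - 1) * |s| ^ (q - 2)) s := by
  have h : HasDerivAt (fun s => |s| ^ (q - 2) * s) ((q - 1) * |s| ^ (q - 2)) s := by
    have hc : Continuous fun s : ℝ => |s| ^ (q - 2) :=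
      continuous_abs.rpow_const fun _ => Or.inr (by linarith)
    have hne : ∀ y : ℝ, y ≠ 0 →
        HasDerivAt (fun s => |s| ^ (q - 2) * s) ((q - 1) * |y| ^ (q - 2)) y := by
      intro y hy
      have h1 := (((hasDerivAt_abs hy).rpow_const (p := q - 2)
        (Or.inl (abs_ne_zero.2 hy))).mul (hasDerivAt_id y))
      refine h1.congr_deriv ?_
      have h2 : (SignType.sign y : ℝ) * y = |y| := sign_mul_self y
      have h3 : |y| ^ (q - 2 - 1) * |y| = |y| ^ (q - 2) := by
        rw [← Real.rpow_add_one (abs_ne_zero.2 hy), sub_add_cancel]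
      simp only [id, mul_one]
      linear_combination (q - 2) * |y| ^ (q - 2 - 1) * h2 + (q - 2) * h3
    -- At 0 the derivative is the continuous extension from s ≠ 0; for q = 2 this relies on `0 ^ 0 =
    -- 1`.
    by_cases hs : s = 0
    · subst hs
      exact hasDerivAt_of_hasDerivAt_of_ne (fun y hy => hne y hy)
        (hc.mul continuous_id).continuousAt (hc.const_mul _).continuousAt
    · exact hne s hs
  exact (h.const_mul q).congr_deriv (by ring)

/-- The dissipation density `|u|^(q-2) u_x²`. -/
noncomputable def dissipation (u : ℝ → ℝ → ℝ) (q x t : ℝ) : ℝ :=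
  |u x t| ^ (q - 2) * spaceDeriv u x t ^ 2

/-- The advection density `b |u|^(q-2) u u_x`. -/
noncomputable def advection (b u : ℝ → ℝ → ℝ) (q x t : ℝ) : ℝ :=
  |u x t| ^ (q - 2) * (b x t * u x t * spaceDeriv u x t)

/-- The spatial cylinder `(-R, R] × ℝ`, a box for measures supported in a time slab. -/
def box (R : ℝ) : Set (ℝ × ℝ) := Ioc (-R) R ×ˢ univ

/-- Lebesgue measure on the slab `ℝ × (r, s]`. -/
noncomputable def slabMeasure (r s : ℝ) : Measure (ℝ × ℝ) :=
  (volume : Measure ℝ).prod (volume.restrict (Ioc r s))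

theorem measurableSet_box (R : ℝ) : MeasurableSet (box R) :=
  measurableSet_Ioc.prod MeasurableSet.univ

theorem slabMeasure_restrict_box (r s R : ℝ) :
    (slabMeasure r s).restrict (box R) =
      (volume.restrict (Ioc (-R) R)).prod (volume.restrict (Ioc r s)) := by
  rw [slabMeasure, box, ← Measure.prod_restrict, Measure.restrict_univ]

theorem aecover_box (r s : ℝ) : AECover (slabMeasure r s) atTop box where
  ae_eventually_mem := ae_of_all _ fun z => by
    filter_upwards [eventually_gt_atTop |z.1|] with R hR
    exact ⟨⟨(abs_lt.1 hR).1, (abs_lt.1 hR).2.le⟩, mem_univ _⟩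
  measurableSet := measurableSet_box

section Slab

variable {T : EReal} {r s : ℝ}

theorem integrableOn_box (hr : r ∈ openTimes T) (hs : s ∈ openTimes T) {f : ℝ → ℝ → ℝ}
    (hf : ContinuousOn (fun z : ℝ × ℝ => f z.1 z.2) (openStrip T)) (R : ℝ) :
    IntegrableOn (fun z : ℝ × ℝ => f z.1 z.2) (box R) (slabMeasure r s) := by
  rw [IntegrableOn, slabMeasure_restrict_box, Measure.prod_restrict]
  have h : ContinuousOn (fun z : ℝ × ℝ => f z.1 z.2) (Icc (-R) R ×ˢ Icc r s) :=
    hf.mono fun z hz => Icc_subset_openTimes hr hs hz.2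
  exact (h.integrableOn_compact (isCompact_Icc.prod isCompact_Icc)).mono_set
    (prod_mono Ioc_subset_Icc_self Ioc_subset_Icc_self)

theorem setIntegral_box (hr : r ∈ openTimes T) (hs : s ∈ openTimes T) (hrs : r ≤ s)
    {f : ℝ → ℝ → ℝ} (hf : ContinuousOn (fun z : ℝ × ℝ => f z.1 z.2) (openStrip T)) {R : ℝ}
    (hR : 0 ≤ R) :
    ∫ z in box R, f z.1 z.2 ∂(slabMeasure r s) = ∫ t in r..s, ∫ x in (-R)..R, f x t := by
  have h := integrableOn_box hr hs hf R
  rw [IntegrableOn, slabMeasure_restrict_box] at h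
  rw [slabMeasure_restrict_box, integral_prod_symm _ h, intervalIntegral.integral_of_le hrs]
  simp only [intervalIntegral.integral_of_le (by linarith : -R ≤ R)]

theorem intervalIntegrable_integral_box (hr : r ∈ openTimes T) (hs : s ∈ openTimes T)
    (hrs : r ≤ s) {f : ℝ → ℝ → ℝ}
    (hf : ContinuousOn (fun z : ℝ × ℝ => f z.1 z.2) (openStrip T)) {R : ℝ} (hR : 0 ≤ R) :
    IntervalIntegrable (fun t => ∫ x in (-R)..R, f x t) volume r s := by
  have h := integrableOn_box hr hs hf R
  rw [IntegrableOn, slabMeasure_restrict_box] at h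
  rw [intervalIntegrable_iff_integrableOn_Ioc_of_le hrs]
  simp only [intervalIntegral.integral_of_le (by linarith : -R ≤ R)]
  exact h.integral_prod_right

end Slab

section Solution

variable {b u : ℝ → ℝ → ℝ} {p₀ q : ℝ} {T : EReal}

theorem IsSolution.continuousOn_abs_rpow (hu : IsSolution b p₀ T u) {r : ℝ} (hr : 0 ≤ r) :
    ContinuousOn (fun z : ℝ × ℝ => |u z.1 z.2| ^ r) (openStrip T) :=
  hu.continuousOn.abs.rpow_const fun _ _ => Or.inr hr

theorem IsSolution.continuousOn_dissipation (hu : IsSolution b p₀ T u) (hq : 2 ≤ q) :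
    ContinuousOn (fun z : ℝ × ℝ => dissipation u q z.1 z.2) (openStrip T) :=
  (hu.continuousOn_abs_rpow (by linarith)).mul (hu.continuousOn_space.pow 2)

theorem IsSolution.continuousOn_advection (hb : IsAdvectionField b) (hu : IsSolution b p₀ T u)
    (hq : 2 ≤ q) :
    ContinuousOn (fun z : ℝ × ℝ => advection b u q z.1 z.2) (openStrip T) :=
  (hu.continuousOn_abs_rpow (by linarith)).mul
    (((hb.continuousOn_strip T).mul hu.continuousOn).mul hu.continuousOn_space)

theorem dissipation_nonneg (x t : ℝ) : 0 ≤ dissipation u q x t := by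
  unfold dissipation; positivity

/-- Young's inequality, weighted to leave half of the dissipation. It serves both for slab
integrability and, with b - β in place of b, for the final estimate. -/
theorem abs_advection_le (hq : 2 ≤ q) {x t Mb : ℝ} (hMb : |b x t| ≤ Mb) :
    |advection b u q x t| ≤ 1 / 2 * dissipation u q x t + Mb ^ 2 / 2 * |u x t| ^ q := by
  unfold advection dissipation
  rw [abs_mul, abs_of_nonneg (by positivity : 0 ≤ |u x t| ^ (q - 2)),
    ← abs_rpow_sub_two_mul_sq hq (u x t)]
  have h1 : |b x t * u x t * spaceDeriv u x t| ≤
      1 / 2 * spaceDeriv u x t ^ 2 + Mb ^ 2 / 2 * u x t ^ 2 := by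
    have h2 : b x t ^ 2 ≤ Mb ^ 2 := sq_le_sq' (abs_le.1 hMb).1 (abs_le.1 hMb).2
    have h3 := mul_le_mul_of_nonneg_right h2 (sq_nonneg (u x t))
    rw [abs_le]
    constructor
    · nlinarith [sq_nonneg (b x t * u x t + spaceDeriv u x t)]
    · nlinarith [sq_nonneg (b x t * u x t - spaceDeriv u x t)]
  calc _ ≤ |u x t| ^ (q - 2) *
        (1 / 2 * spaceDeriv u x t ^ 2 + Mb ^ 2 / 2 * u x t ^ 2) := by gcongr
    _ = _ := by ring

/-- The entropy production for `η(s) = |s|^q`. -/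
noncomputable def powProduction (b u : ℝ → ℝ → ℝ) (q R x t : ℝ) : ℝ :=
  entropyProduction b u (fun s => |s| ^ q) (fun s => q * (|s| ^ (q - 2) * s))
    (fun s => q * (q - 1) * |s| ^ (q - 2)) R x t

theorem powProduction_eq (hq : 2 ≤ q) (R x t : ℝ) :
    powProduction b u q R x t =
      q * (q - 1) * (advection b u q x t - dissipation u q x t) * cutoff R x +
        (q * b x t * cutoffDeriv R x + cutoffDeriv2 R x) * |u x t| ^ q := by
  unfold powProduction entropyProduction advection dissipation
  linear_combination q * b x t * cutoffDeriv R x * abs_rpow_sub_two_mul_sq hq (u x t)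

/-- The remainder carries only derivatives of the cutoff, so it is dominated by a multiple of |u|^q
and disappears as R → ∞. -/
theorem abs_powProduction_sub_le (hq : 2 ≤ q) {R x t Mb : ℝ} (hMb : |b x t| ≤ Mb) (hR : 1 ≤ R)
    (hx : x ∈ Icc (-R) R) :
    |powProduction b u q R x t -
      q * (q - 1) * (advection b u q x t - dissipation u q x t) * cutoff R x| ≤
      (4 * q * Mb + 8) / R * |u x t| ^ q := by
  have hR0 : 0 < R := by linarith
  rw [powProduction_eq hq, add_sub_cancel_left, abs_mul,
    abs_of_nonneg (by positivity : 0 ≤ |u x t| ^ q)]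
  gcongr
  calc |q * b x t * cutoffDeriv R x + cutoffDeriv2 R x|
      ≤ |q * b x t * cutoffDeriv R x| + |cutoffDeriv2 R x| := abs_add_le _ _
    _ ≤ q * Mb * (4 / R) + 8 / R := by
        rw [abs_mul, abs_mul, abs_of_nonneg (by linarith : 0 ≤ q)]
        have := (abs_nonneg _).trans hMb
        gcongr
        · exact abs_cutoffDeriv_le hR hx
        · exact abs_cutoffDeriv2_le hR hx
    _ = _ := by ring

theorem continuousOn_powProduction (hb : IsAdvectionField b) (hu : IsSolution b p₀ T u)
    (hq : 2 ≤ q) (R : ℝ) :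
    ContinuousOn (fun z : ℝ × ℝ => powProduction b u q R z.1 z.2) (openStrip T) := by
  have hc : ∀ {r : ℝ}, 0 ≤ r → Continuous fun s : ℝ => |s| ^ r := fun hr =>
    continuous_abs.rpow_const fun _ => Or.inr hr
  exact continuousOn_entropyProduction hb hu (hc (by linarith))
    (((hc (by linarith)).mul continuous_id).const_mul q) ((hc (by linarith)).const_mul _) R

theorem integral_abs_rpow_cutoff_sub (hb : IsAdvectionField b) (hu : IsSolution b p₀ T u)
    (hq : 2 ≤ q) {r s : ℝ} (hr : r ∈ openTimes T) (hs : s ∈ openTimes T) (hrs : r ≤ s) {R : ℝ}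
    (hR : 0 < R) :
    (∫ x in (-R)..R, |u x s| ^ q * cutoff R x) - ∫ x in (-R)..R, |u x r| ^ q * cutoff R x =
      ∫ z in box R, powProduction b u q R z.1 z.2 ∂(slabMeasure r s) := by
  rw [setIntegral_box hr hs hrs (continuousOn_powProduction hb hu hq R) hR.le]
  refine (intervalIntegral.integral_eq_sub_of_hasDerivAt
    (f := fun t => ∫ x in (-R)..R, |u x t| ^ q * cutoff R x) (fun t ht => ?_)
    (intervalIntegrable_integral_box hr hs hrs (continuousOn_powProduction hb hu hq R)
      hR.le)).symm
  rw [uIcc_of_le hrs] at ht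
  exact hasDerivAt_integral_entropy hb hu (η := fun s => |s| ^ q)
    (fun s => (hasDerivAt_abs_rpow s (by linarith : 1 < q)).congr_deriv (mul_assoc _ _ _))
    (hasDerivAt_abs_rpow_sub_two_mul hq)
    ((continuous_abs.rpow_const fun _ => Or.inr (by linarith)).const_mul _) hR
    (Icc_subset_openTimes hr hs ht)

section Bounded

variable {C : ℝ} {r s : ℝ}

theorem setIntegral_box_abs_rpow_le (hu : IsSolution b p₀ T u) (hq : 2 ≤ q)
    (hr : r ∈ openTimes T) (hs : s ∈ openTimes T) (hrs : r ≤ s)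
    (hC : ∀ t ∈ Icc r s, Integrable (fun x => |u x t| ^ q) ∧ ∫ x, |u x t| ^ q ≤ C) {R : ℝ}
    (hR : 0 ≤ R) :
    ∫ z in box R, |u z.1 z.2| ^ q ∂(slabMeasure r s) ≤ C * (s - r) := by
  rw [setIntegral_box hr hs hrs (f := fun x t => |u x t| ^ q)
    (hu.continuousOn_abs_rpow (by linarith)) hR]
  refine (le_abs_self _).trans ?_
  have := intervalIntegral.norm_integral_le_of_norm_le_const (a := r) (b := s) (C := C)
    (f := fun t => ∫ x in (-R)..R, |u x t| ^ q) fun t ht => by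
      rw [uIoc_of_le hrs] at ht
      obtain ⟨h1, h2⟩ := hC t (Ioc_subset_Icc_self ht)
      rw [intervalIntegral.integral_of_le (by linarith), Real.norm_eq_abs,
        abs_of_nonneg (integral_nonneg fun x => by positivity)]
      exact (setIntegral_le_integral h1 (ae_of_all _ fun x => by positivity)).trans h2
  rwa [abs_of_nonneg (sub_nonneg.2 hrs)] at this

theorem integrable_slab_abs_rpow (hu : IsSolution b p₀ T u) (hq : 2 ≤ q)
    (hr : r ∈ openTimes T) (hs : s ∈ openTimes T) (hrs : r ≤ s)
    (hC : ∀ t ∈ Icc r s, Integrable (fun x => |u x t| ^ q) ∧ ∫ x, |u x t| ^ q ≤ C) :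
    Integrable (fun z : ℝ × ℝ => |u z.1 z.2| ^ q) (slabMeasure r s) := by
  refine (aecover_box r s).integrable_of_integral_bounded_of_nonneg_ae (C * (s - r))
    (fun R => integrableOn_box hr hs (f := fun x t => |u x t| ^ q)
      (hu.continuousOn_abs_rpow (by linarith)) R) (ae_of_all _ fun z => by positivity) ?_
  filter_upwards [eventually_ge_atTop 0] with R hR
    using setIntegral_box_abs_rpow_le hu hq hr hs hrs hC hR

/-- After half the dissipation absorbs the advection, the localized balance bounds the weighted
remainder uniformly in R; nonnegativity turns this into integrability. -/
theorem integrable_slab_dissipation (hb : IsAdvectionField b) (hu : IsSolution b p₀ T u)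
    (hq : 2 ≤ q) (hr : r ∈ openTimes T) (hs : s ∈ openTimes T) (hrs : r ≤ s)
    (hC : ∀ t ∈ Icc r s, Integrable (fun x => |u x t| ^ q) ∧ ∫ x, |u x t| ^ q ≤ C) :
    Integrable (fun z : ℝ × ℝ => dissipation u q z.1 z.2) (slabMeasure r s) := by
  obtain ⟨Mb, hMb0, hMb⟩ := hb.exists_bound
  have hX := integrable_slab_abs_rpow hu hq hr hs hrs hC
  have hD := hu.continuousOn_dissipation hq
  set c := q * (q - 1) / 2 with hc
  have hc0 : 0 < c := by
    have : 0 < q - 1 := by linarith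
    positivity
  set E := c * Mb ^ 2 + (4 * q * Mb + 8) with hE
  have hE0 : 0 ≤ E := by positivity
  have key : ∀ R : ℝ, 1 ≤ R →
      c * ∫ z in box R, dissipation u q z.1 z.2 * cutoff R z.1 ∂(slabMeasure r s) ≤
        E * (C * (s - r)) + C := by
    intro R hR
    have hR0 : 0 < R := by linarith
    have hDc : ContinuousOn (fun z : ℝ × ℝ => dissipation u q z.1 z.2 * cutoff R z.1)
      (openStrip T) := hD.mul ((continuous_cutoff R).comp continuous_fst).continuousOn
    have i1 := integrableOn_box hr hs (f := fun x t => dissipation u q x t * cutoff R x) hDc R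
    have i2 := integrableOn_box hr hs (continuousOn_powProduction hb hu hq R) R
    have h1 : ∫ z in box R, (c * (dissipation u q z.1 z.2 * cutoff R z.1) +
        powProduction b u q R z.1 z.2) ∂(slabMeasure r s) ≤
        ∫ z in box R, E * |u z.1 z.2| ^ q ∂(slabMeasure r s) := by
      have hae : ∀ᵐ z ∂(slabMeasure r s).restrict (box R), z.1 ∈ Ioc (-R) R ∧ z.2 ∈ Ioc r s := by
        rw [slabMeasure_restrict_box, Measure.prod_restrict]
        exact ae_restrict_mem (measurableSet_Ioc.prod measurableSet_Ioc)
      refine integral_mono_ae ((i1.const_mul c).add i2) (hX.integrableOn.const_mul E) ?_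
      filter_upwards [hae] with z hz
      have hx : z.1 ∈ Icc (-R) R := Ioc_subset_Icc_self hz.1
      have hbz := hMb z.1 z.2 (hr.1.trans hz.2.1).le
      have a1 := (abs_le.1 (abs_powProduction_sub_le (b := b) (u := u) hq hbz hR hx)).2
      have a2 := (abs_le.1 (abs_advection_le (u := u) hq hbz)).2
      have a3 := cutoff_nonneg R z.1
      have a4 := cutoff_le_one hR0 hx
      have a5 : 0 ≤ |u z.1 z.2| ^ q := by positivity
      have a6 : (4 * q * Mb + 8) / R * |u z.1 z.2| ^ q ≤ (4 * q * Mb + 8) * |u z.1 z.2| ^ q := by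
        gcongr
        exact div_le_self (by positivity) hR
      have a7 : 2 * c * (advection b u q z.1 z.2 - dissipation u q z.1 z.2) * cutoff R z.1 ≤
          2 * c * (Mb ^ 2 / 2 * |u z.1 z.2| ^ q - 1 / 2 * dissipation u q z.1 z.2) *
            cutoff R z.1 :=
        mul_le_mul_of_nonneg_right
          (mul_le_mul_of_nonneg_left (by linarith) (by positivity)) a3
      have a8 : c * Mb ^ 2 * |u z.1 z.2| ^ q * cutoff R z.1 ≤ c * Mb ^ 2 * |u z.1 z.2| ^ q :=
        mul_le_of_le_one_right (by positivity) a4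
      have e : q * (q - 1) = 2 * c := by rw [hc]; ring
      rw [e] at a1
      simp only [hE]
      linarith
    have hsp := integral_add (i1.const_mul c) i2
    have hb1 := setIntegral_box_abs_rpow_le hu hq hr hs hrs hC hR0.le
    rw [integral_const_mul] at h1
    have hsp' : ∫ z in box R, (c * (dissipation u q z.1 z.2 * cutoff R z.1) +
        powProduction b u q R z.1 z.2) ∂(slabMeasure r s) =
        c * (∫ z in box R, dissipation u q z.1 z.2 * cutoff R z.1 ∂(slabMeasure r s)) +
        ∫ z in box R, powProduction b u q R z.1 z.2 ∂(slabMeasure r s) := by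
      rw [← integral_const_mul]; exact hsp
    rw [hsp', ← integral_abs_rpow_cutoff_sub hb hu hq hr hs hrs hR0] at h1
    have h2 : 0 ≤ ∫ x in (-R)..R, |u x s| ^ q * cutoff R x :=
      intervalIntegral.integral_nonneg (by linarith) fun x _ =>
        mul_nonneg (by positivity) (cutoff_nonneg _ _)
    have h3 : ∫ x in (-R)..R, |u x r| ^ q * cutoff R x ≤ C := by
      obtain ⟨g1, g2⟩ := hC r ⟨le_rfl, hrs⟩
      have hcr : Continuous fun x => |u x r| ^ q :=
        (continuous_slice hu.continuousOn hr).abs.rpow_const fun _ => Or.inr (by linarith)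
      refine (intervalIntegral.integral_mono_on (by linarith)
        ((hcr.mul (continuous_cutoff R)).intervalIntegrable _ _) (hcr.intervalIntegrable _ _)
        fun x hx => mul_le_of_le_one_right (by positivity) (cutoff_le_one hR0 hx)).trans ?_
      rw [intervalIntegral.integral_of_le (by linarith)]
      exact (setIntegral_le_integral g1 (ae_of_all _ fun x => by positivity)).trans g2
    have h4 := mul_le_mul_of_nonneg_left hb1 hE0
    linarith
  refine (aecover_box r s).integrable_of_integral_bounded_of_nonneg_ae
    (16 / 9 * ((E * (C * (s - r)) + C) / c))
    (fun R => integrableOn_box hr hs hD R) (ae_of_all _ fun z => dissipation_nonneg _ _) ?_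
  filter_upwards [eventually_ge_atTop 1] with n hn
  -- Doubling the radius makes the weight at least 9/16 on the box of radius n, whence the factor
  -- 16/9.
  have hk := key (2 * n) (by linarith)
  rw [mul_comm, ← le_div_iff₀ hc0] at hk
  have hDc : ContinuousOn (fun z : ℝ × ℝ => dissipation u q z.1 z.2 * cutoff (2 * n) z.1)
      (openStrip T) := hD.mul ((continuous_cutoff (2 * n)).comp continuous_fst).continuousOn
  have hi := integrableOn_box hr hs (f := fun x t => dissipation u q x t * cutoff (2 * n) x) hDc
  have h1 : ∫ z in box n, 9 / 16 * dissipation u q z.1 z.2 ∂(slabMeasure r s) ≤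
      ∫ z in box (2 * n), dissipation u q z.1 z.2 * cutoff (2 * n) z.1 ∂(slabMeasure r s) := by
    refine (setIntegral_mono_on ((integrableOn_box hr hs hD n).const_mul _) (hi n)
      (measurableSet_box n) fun z hz => ?_).trans (setIntegral_mono_set (hi (2 * n))
        (ae_of_all _ fun z => mul_nonneg (dissipation_nonneg _ _) (cutoff_nonneg _ _))
        (LE.le.eventuallyLE fun z hz =>
          ⟨⟨by linarith [hz.1.1], by linarith [hz.1.2]⟩, mem_univ _⟩))
    have h4 : 9 / 16 ≤ cutoff (2 * n) z.1 :=
      le_cutoff (by linarith) ⟨by linarith [hz.1.1], by linarith [hz.1.2]⟩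
    rw [mul_comm]
    exact mul_le_mul_of_nonneg_left h4 (dissipation_nonneg _ _)
  rw [integral_const_mul] at h1
  linarith

theorem integrable_slab_advection (hb : IsAdvectionField b) (hu : IsSolution b p₀ T u)
    (hq : 2 ≤ q) (hr : r ∈ openTimes T) (hs : s ∈ openTimes T) (hrs : r ≤ s)
    (hC : ∀ t ∈ Icc r s, Integrable (fun x => |u x t| ^ q) ∧ ∫ x, |u x t| ^ q ≤ C) :
    Integrable (fun z : ℝ × ℝ => advection b u q z.1 z.2) (slabMeasure r s) := by
  obtain ⟨Mb, hMb0, hMb⟩ := hb.exists_bound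
  have hae : ∀ᵐ z ∂(slabMeasure r s), z.2 ∈ Ioc r s := by
    have : slabMeasure r s = (volume.prod volume).restrict (univ ×ˢ Ioc r s) := by
      rw [slabMeasure, ← Measure.prod_restrict, Measure.restrict_univ]
    rw [this]
    filter_upwards [ae_restrict_mem (MeasurableSet.univ.prod measurableSet_Ioc)] with z hz
      using hz.2
  refine (((integrable_slab_dissipation hb hu hq hr hs hrs hC).const_mul (1 / 2)).add
    ((integrable_slab_abs_rpow hu hq hr hs hrs hC).const_mul (Mb ^ 2 / 2))).mono'
    ((aecover_box r s).aestronglyMeasurable fun R =>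
      (integrableOn_box hr hs (hu.continuousOn_advection hb hq) R).aestronglyMeasurable) ?_
  filter_upwards [hae] with z hz
    using abs_advection_le hq (hMb z.1 z.2 (hr.1.trans hz.1).le)

theorem tendsto_cutoff (x : ℝ) : Tendsto (fun R => cutoff R x) atTop (𝓝 1) := by
  have h : Tendsto (fun R : ℝ => x / R) atTop (𝓝 0) := tendsto_const_nhds.div_atTop tendsto_id
  have := ((h.pow 2).const_sub 1).pow 2
  simpa [cutoff] using this

theorem tendsto_integral_mul_cutoff {f : ℝ → ℝ} (hf : Integrable f) :
    Tendsto (fun R => ∫ x in (-R)..R, f x * cutoff R x) atTop (𝓝 (∫ x, f x)) := by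
  have h : Tendsto (fun R => ∫ x, (Ioc (-R) R).indicator (fun x => f x * cutoff R x) x) atTop
      (𝓝 (∫ x, f x)) := by
    refine tendsto_integral_filter_of_dominated_convergence (fun x => |f x|)
      (Eventually.of_forall fun R => ?_) ?_ hf.abs (ae_of_all _ fun x => ?_)
    · exact (hf.1.mul (continuous_cutoff R).aestronglyMeasurable).indicator measurableSet_Ioc
    · filter_upwards [eventually_gt_atTop 0] with R hR
      refine ae_of_all _ fun x => ?_
      by_cases hx : x ∈ Ioc (-R) R
      · rw [indicator_of_mem hx, norm_mul, Real.norm_eq_abs, Real.norm_eq_abs,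
          abs_of_nonneg (cutoff_nonneg R x)]
        exact mul_le_of_le_one_right (abs_nonneg _)
          (cutoff_le_one hR (Ioc_subset_Icc_self hx))
      · rw [indicator_of_notMem hx, norm_zero]
        exact abs_nonneg _
    · have h1 := (tendsto_cutoff x).const_mul (f x)
      rw [mul_one] at h1
      refine h1.congr' ?_
      filter_upwards [eventually_gt_atTop |x|] with R hR
      rw [indicator_of_mem (show x ∈ Ioc (-R) R from ⟨(abs_lt.1 hR).1, (abs_lt.1 hR).2.le⟩)]
  refine h.congr' ?_
  filter_upwards [eventually_gt_atTop 0] with R hR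
  rw [integral_indicator measurableSet_Ioc, intervalIntegral.integral_of_le (by linarith)]

/-- The integrated energy balance on the whole line. -/
theorem integral_abs_rpow_sub_eq (hb : IsAdvectionField b) (hu : IsSolution b p₀ T u)
    (hq : 2 ≤ q) (hr : r ∈ openTimes T) (hs : s ∈ openTimes T) (hrs : r ≤ s)
    (hC : ∀ t ∈ Icc r s, Integrable (fun x => |u x t| ^ q) ∧ ∫ x, |u x t| ^ q ≤ C) :
    (∫ x, |u x s| ^ q) - ∫ x, |u x r| ^ q =
      ∫ z, q * (q - 1) * (advection b u q z.1 z.2 - dissipation u q z.1 z.2)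
        ∂(slabMeasure r s) := by
  obtain ⟨Mb, hMb0, hMb⟩ := hb.exists_bound
  have hX := integrable_slab_abs_rpow hu hq hr hs hrs hC
  have hG := ((integrable_slab_advection hb hu hq hr hs hrs hC).sub
    (integrable_slab_dissipation hb hu hq hr hs hrs hC)).const_mul (q * (q - 1))
  have hae : ∀ᵐ z ∂(slabMeasure r s), z.2 ∈ Ioc r s := by
    have : slabMeasure r s = (volume.prod volume).restrict (univ ×ˢ Ioc r s) := by
      rw [slabMeasure, ← Measure.prod_restrict, Measure.restrict_univ]
    rw [this]
    filter_upwards [ae_restrict_mem (MeasurableSet.univ.prod measurableSet_Ioc)] with z hz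
      using hz.2
  have hL := (tendsto_integral_mul_cutoff (hC s ⟨hrs, le_rfl⟩).1).sub
    (tendsto_integral_mul_cutoff (hC r ⟨le_rfl, hrs⟩).1)
  refine tendsto_nhds_unique hL ?_
  set G : ℝ × ℝ → ℝ := fun z =>
    q * (q - 1) * (advection b u q z.1 z.2 - dissipation u q z.1 z.2)
  -- Dominated convergence: the production is the weighted density G plus an O(1/R) remainder, both
  -- dominated on the slab.
  have hR : Tendsto (fun R => ∫ z, (box R).indicator
      (fun z => powProduction b u q R z.1 z.2) z ∂(slabMeasure r s)) atTop
      (𝓝 (∫ z, G z ∂(slabMeasure r s))) := by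
    refine tendsto_integral_filter_of_dominated_convergence
      (fun z => |G z| + (4 * q * Mb + 8) * |u z.1 z.2| ^ q)
      (Eventually.of_forall fun R => ?_) ?_ (hG.abs.add (hX.const_mul _)) ?_
    · exact ((integrable_indicator_iff (measurableSet_box R)).2 (integrableOn_box hr hs
        (continuousOn_powProduction hb hu hq R) R)).aestronglyMeasurable
    · filter_upwards [eventually_ge_atTop 1] with R hR
      filter_upwards [hae] with z hz
      have hR0 : 0 < R := by linarith
      by_cases hx : z ∈ box R
      · have hx' : z.1 ∈ Icc (-R) R := Ioc_subset_Icc_self hx.1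
        rw [indicator_of_mem hx, Real.norm_eq_abs]
        have h1 := abs_powProduction_sub_le (b := b) (u := u) hq
          (hMb z.1 z.2 (hr.1.trans hz.1).le) hR hx'
        have h2 : |G z * cutoff R z.1| ≤ |G z| := by
          rw [abs_mul, abs_of_nonneg (cutoff_nonneg _ _)]
          exact mul_le_of_le_one_right (abs_nonneg _) (cutoff_le_one hR0 hx')
        have h3 : (4 * q * Mb + 8) / R * |u z.1 z.2| ^ q ≤
            (4 * q * Mb + 8) * |u z.1 z.2| ^ q := by
          gcongr
          exact div_le_self (by positivity) hR
        have h4 := abs_add_le (powProduction b u q R z.1 z.2 - G z * cutoff R z.1)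
          (G z * cutoff R z.1)
        rw [sub_add_cancel] at h4
        exact h4.trans (by linarith)
      · rw [indicator_of_notMem hx, norm_zero]
        positivity
    · filter_upwards [hae] with z hz
      have hlim0 : Tendsto (fun R : ℝ => (4 * q * Mb + 8) / R * |u z.1 z.2| ^ q) atTop (𝓝 0) := by
        simpa using ((tendsto_const_nhds (x := 4 * q * Mb + 8)).div_atTop
          tendsto_id).mul_const (|u z.1 z.2| ^ q)
      have hrem : Tendsto (fun R => powProduction b u q R z.1 z.2 - G z * cutoff R z.1) atTop
          (𝓝 0) := by
        refine squeeze_zero_norm' ?_ hlim0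
        filter_upwards [eventually_ge_atTop 1, eventually_ge_atTop |z.1|] with R hR hR2
          using abs_powProduction_sub_le (b := b) (u := u) hq
            (hMb z.1 z.2 (hr.1.trans hz.1).le) hR (abs_le.1 hR2)
      have h1 := hrem.add ((tendsto_cutoff z.1).const_mul (G z))
      rw [mul_one, zero_add] at h1
      refine h1.congr' ?_
      filter_upwards [eventually_gt_atTop |z.1|] with R hR
      rw [indicator_of_mem (show z ∈ box R from
        ⟨⟨(abs_lt.1 hR).1, (abs_lt.1 hR).2.le⟩, mem_univ _⟩), sub_add_cancel]
  refine hR.congr' ?_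
  filter_upwards [eventually_gt_atTop 0] with R hR
  rw [integral_indicator (measurableSet_box R),
    integral_abs_rpow_cutoff_sub hb hu hq hr hs hrs hR]

end Bounded

end Solution

/-! ### Norms as integrals, and the oscillation of b. -/

theorem memLp_of_integrable_abs_rpow {f : ℝ → ℝ} {q : ℝ} (hq : 0 < q)
    (hf : AEStronglyMeasurable f volume) (hi : Integrable fun x => |f x| ^ q) :
    MemLp f (ENNReal.ofReal q) volume := by
  rw [← integrable_norm_rpow_iff hf (by simpa using hq) (by simp), ENNReal.toReal_ofReal hq.le]
  exact hi

theorem integrable_abs_rpow_of_memLp {f : ℝ → ℝ} {q : ℝ} (hq : 0 < q)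
    (hf : MemLp f (ENNReal.ofReal q) volume) : Integrable fun x => |f x| ^ q := by
  have h := hf.integrable_norm_rpow (by simpa using hq) ENNReal.ofReal_ne_top
  rw [ENNReal.toReal_ofReal hq.le] at h
  exact h

theorem eLpNorm_ofReal_eq {f : ℝ → ℝ} {q : ℝ} (hq : 0 < q)
    (hf : MemLp f (ENNReal.ofReal q) volume) :
    eLpNorm f (ENNReal.ofReal q) volume = ENNReal.ofReal ((∫ x, |f x| ^ q) ^ (1 / q)) := by
  rw [hf.eLpNorm_eq_integral_rpow_norm (by simpa using hq) (by simp), ENNReal.toReal_ofReal hq.le,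
    one_div]
  rfl

theorem normPow_eq {u : ℝ → ℝ → ℝ} {q t : ℝ} (hq : 0 < q)
    (hf : MemLp (fun x => u x t) (ENNReal.ofReal q) volume) :
    normPow u q t = ∫ x, |u x t| ^ q := by
  have h0 : 0 ≤ ∫ x, |u x t| ^ q := integral_nonneg fun x => by positivity
  rw [normPow, eLpNorm_ofReal_eq hq hf, ENNReal.toReal_ofReal (by positivity), one_div,
    Real.rpow_inv_rpow h0 hq.ne']

section Advection

variable {b : ℝ → ℝ → ℝ} {t : ℝ}

theorem IsAdvectionField.abs_sub_midValue_le (hb : IsAdvectionField b) (ht : 0 ≤ t) (x : ℝ) :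
    |b x t - midValue b t| ≤ halfOsc b t := by
  obtain ⟨M, -, hM⟩ := hb.exists_bound
  have h1 : b x t ≤ ⨆ y, b y t :=
    le_ciSup (f := fun y => b y t) ⟨M, by rintro _ ⟨y, rfl⟩; exact (abs_le.1 (hM y t ht)).2⟩ x
  have h2 : ⨅ y, b y t ≤ b x t :=
    ciInf_le (f := fun y => b y t) ⟨-M, by rintro _ ⟨y, rfl⟩; exact (abs_le.1 (hM y t ht)).1⟩ x
  unfold midValue halfOsc
  rw [abs_le]
  constructor <;> linarith

theorem IsAdvectionField.halfOsc_nonneg (hb : IsAdvectionField b) (ht : 0 ≤ t) :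
    0 ≤ halfOsc b t :=
  (abs_nonneg _).trans (hb.abs_sub_midValue_le ht 0)

end Advection

/-! ### The energy identity at almost every time and its consequence. -/

section Solution

variable {b u : ℝ → ℝ → ℝ} {p₀ q : ℝ} {T : EReal}

theorem IsSolution.memLp (hb : IsAdvectionField b) (hT : 0 < T) (hu : IsSolution b p₀ T u)
    (hp₀ : 1 ≤ p₀) {p : ℝ} (hp : p₀ ≤ p) {t : ℝ} (ht : 0 ≤ t) (htT : (t : EReal) < T) :
    MemLp (fun x => u x t) (ENNReal.ofReal p) volume := by
  obtain ⟨C, hC⟩ := exists_integral_abs_rpow_le hb hT hu hp₀ hp htT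
  exact memLp_of_integrable_abs_rpow (by linarith) (hu.aestronglyMeasurable ht htT)
    (hC t ht le_rfl).1

/-- The identity holds wherever the densities are integrable and the integrated energy balance can
be differentiated. -/
theorem energyIdentityAt_of_hasDerivAt (hb : IsAdvectionField b) (hT : 0 < T)
    (hu : IsSolution b p₀ T u) (hp₀ : 1 ≤ p₀) (hq : 2 * p₀ ≤ q) {t : ℝ} (ht : t ∈ openTimes T)
    (hD : Integrable fun x => dissipation u q x t) (hA : Integrable fun x => advection b u q x t)
    (hN : HasDerivAt (fun t => ∫ x, |u x t| ^ q)
      (∫ x, q * (q - 1) * (advection b u q x t - dissipation u q x t)) t) :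
    EnergyIdentityAt b u q t := by
  have hq0 : 0 < q := by linarith
  have hX : Integrable fun x => |u x t| ^ q := by
    obtain ⟨C, hC⟩ := exists_integral_abs_rpow_le hb hT hu hp₀ (by linarith : p₀ ≤ q) ht.2
    exact (hC t ht.1.le le_rfl).1
  have hw : ∀ x, HasDerivAt (fun y => u y t) (spaceDeriv u x t) x :=
    fun x => hu.hasDerivAt_space x ht
  have hp : 1 ≤ q / 2 := by linarith
  have e : 2 * (q / 2) = q := by ring
  have hX' : Integrable fun x => |u x t| ^ (2 * (q / 2)) := by rwa [e]
  have hD' : Integrable fun x => |u x t| ^ (2 * (q / 2) - 2) * spaceDeriv u x t ^ 2 := by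
    rw [e]; exact hD
  have hW := integrable_abs_rpow_mul_deriv hp hw hX' hD'
  have hd := hasDerivAt_abs_rpow_comp hp hw
  rw [e] at hW hd
  -- The integrand is the derivative of |u|^q/q, so replacing b by b - β does not change the
  -- advection integral.
  have hW0 : ∫ x, |u x t| ^ (q - 2) * u x t * spaceDeriv u x t = 0 := by
    have := integral_eq_zero_of_hasDerivAt_of_integrable hd (hW.const_mul q) hX
    rw [integral_const_mul] at this
    exact (mul_eq_zero.1 this).resolve_left hq0.ne'
  have eA : (fun x => (b x t - midValue b t) * |u x t| ^ (q - 2) * u x t * spaceDeriv u x t) =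
      fun x => advection b u q x t -
        midValue b t * (|u x t| ^ (q - 2) * u x t * spaceDeriv u x t) := by
    funext x; unfold advection; ring
  have eD : (fun x => |u x t| ^ (q - 2) * |spaceDeriv u x t| ^ 2) =
      fun x => dissipation u q x t := by
    funext x; unfold dissipation; rw [sq_abs]
  have hN' : HasDerivAt (normPow u q)
      (∫ x, q * (q - 1) * (advection b u q x t - dissipation u q x t)) t := by
    refine hN.congr_of_eventuallyEq ?_
    filter_upwards [(isOpen_openTimes T).mem_nhds ht] with τ hτ
    exact normPow_eq hq0 (hu.memLp hb hT hp₀ (by linarith) hτ.1.le hτ.2)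
  refine ⟨fun x => (hw x).differentiableAt, ?_, ?_, hN'.differentiableAt.differentiableWithinAt, ?_⟩
  · rw [eD]; exact hD
  · rw [eA]; exact hA.sub (hW.const_mul _)
  · rw [derivWithin_of_mem_nhds (Ici_mem_nhds ht.1), hN'.deriv, eD, eA,
      integral_sub hA (hW.const_mul _), integral_const_mul, integral_const_mul, hW0,
      integral_sub hA hD]
    ring

/-- By Fubini the space integral `g` is integrable in time and the densities are integrable in x for
almost every t. The energy is the indefinite integral of `g`, so Lebesgue differentiation applies.
-/
theorem ae_energyIdentityAt (hb : IsAdvectionField b) (hT : 0 < T)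
    (hu : IsSolution b p₀ T u) (hp₀ : 1 ≤ p₀) (hq : 2 * p₀ ≤ q) {r s : ℝ} (hr : r ∈ openTimes T)
    (hs : s ∈ openTimes T) (hrs : r ≤ s) :
    ∀ᵐ t, t ∈ Ioo r s → EnergyIdentityAt b u q t := by
  have hq2 : 2 ≤ q := by linarith
  obtain ⟨C, hC⟩ := exists_integral_abs_rpow_le hb hT hu hp₀ (by linarith : p₀ ≤ q) hs.2
  have hC' : ∀ t ∈ Icc r s, Integrable (fun x => |u x t| ^ q) ∧ ∫ x, |u x t| ^ q ≤ C :=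
    fun t ht => hC t (hr.1.le.trans ht.1) ht.2
  have hD := integrable_slab_dissipation hb hu hq2 hr hs hrs hC'
  have hA := integrable_slab_advection hb hu hq2 hr hs hrs hC'
  set g : ℝ → ℝ := fun t => ∫ x, q * (q - 1) * (advection b u q x t - dissipation u q x t) with hg
  have hgi : IntervalIntegrable g volume r s := by
    rw [intervalIntegrable_iff_integrableOn_Ioc_of_le hrs]
    exact ((hA.sub hD).const_mul (q * (q - 1))).integral_prod_right
  have hN : ∀ t ∈ Icc r s, ∫ x, |u x t| ^ q = (∫ x, |u x r| ^ q) + ∫ τ in r..t, g τ := by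
    intro t ht
    have htT := Icc_subset_openTimes hr hs ht
    have hCt : ∀ τ ∈ Icc r t, Integrable (fun x => |u x τ| ^ q) ∧ ∫ x, |u x τ| ^ q ≤ C :=
      fun τ hτ => hC' τ ⟨hτ.1, hτ.2.trans ht.2⟩
    have h1 := integral_abs_rpow_sub_eq hb hu hq2 hr htT ht.1 hCt
    have hi := ((integrable_slab_advection hb hu hq2 hr htT ht.1 hCt).sub
      (integrable_slab_dissipation hb hu hq2 hr htT ht.1 hCt)).const_mul (q * (q - 1))
    have h2 : ∫ z, q * (q - 1) * (advection b u q z.1 z.2 - dissipation u q z.1 z.2)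
        ∂(slabMeasure r t) = ∫ τ in r..t, g τ := by
      rw [intervalIntegral.integral_of_le ht.1]
      exact integral_prod_symm _ hi
    linarith
  have hDs := (ae_restrict_iff' measurableSet_Ioc).1 hD.prod_left_ae
  have hAs := (ae_restrict_iff' measurableSet_Ioc).1 hA.prod_left_ae
  filter_upwards [hgi.ae_hasDerivAt_integral, hDs, hAs] with t h1 h2 h3 ht
  have htc : t ∈ Ioc r s := Ioo_subset_Ioc_self ht
  refine energyIdentityAt_of_hasDerivAt hb hT hu hp₀ hq
    (Icc_subset_openTimes hr hs (Ioo_subset_Icc_self ht)) (h2 htc) (h3 htc) ?_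
  have h4 := h1 (by rw [uIcc_of_le hrs]; exact Ioo_subset_Icc_self ht) r left_mem_uIcc
  refine (h4.const_add (∫ x, |u x r| ^ q)).congr_of_eventuallyEq ?_
  filter_upwards [Icc_mem_nhds ht.1 ht.2] with τ hτ using hN τ hτ

theorem volume_exceptionalTimes (hb : IsAdvectionField b) (hT : 0 < T)
    (hu : IsSolution b p₀ T u) (hp₀ : 1 ≤ p₀) (hq : 2 * p₀ ≤ q) :
    volume (exceptionalTimes b u T q) = 0 := by
  have hpos : volume (exceptionalTimes b u T q ∩ openTimes T) = 0 := by
    refine measure_null_of_locally_null _ fun t ht => ?_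
    obtain ⟨ε, hε, hball⟩ := Metric.nhds_basis_closedBall.mem_iff.1
      ((isOpen_openTimes T).mem_nhds ht.2)
    rw [Real.closedBall_eq_Icc] at hball
    have h1 := ae_energyIdentityAt hb hT hu hp₀ hq (hball ⟨le_rfl, by linarith⟩)
      (hball ⟨by linarith, le_rfl⟩) (by linarith : t - ε ≤ t + ε)
    refine ⟨exceptionalTimes b u T q ∩ openTimes T ∩ Ioo (t - ε) (t + ε),
      inter_mem self_mem_nhdsWithin
        (mem_nhdsWithin_of_mem_nhds (Ioo_mem_nhds (by linarith) (by linarith))), ?_⟩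
    refine measure_mono_null (fun τ hτ => ?_) (ae_iff.1 h1)
    exact fun h => hτ.1.1.2.2 (h hτ.2)
  -- The time 0 may be exceptional, but it is a single point.
  have hsub : exceptionalTimes b u T q ⊆ (exceptionalTimes b u T q ∩ openTimes T) ∪ {0} := by
    intro t ht
    rcases ht.1.eq_or_lt with h | h
    · exact Or.inr h.symm
    · exact Or.inl ⟨ht, h, ht.2.1⟩
  exact measure_mono_null hsub (measure_union_null hpos (by simp))

/-- When the `L^q` norm does not decrease, the dissipation is controlled by the oscillation of the
advection field. -/
theorem EnergyIdentityAt.dissipation_le {p t : ℝ} (hb : IsAdvectionField b) (hp : 1 ≤ p)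
    (ht : 0 ≤ t) (hX : Integrable fun x => |u x t| ^ (2 * p))
    (hE : EnergyIdentityAt b u (2 * p) t)
    (hd : 0 ≤ derivWithin (normPow u (2 * p)) (Ici 0) t) :
    p ^ 2 * ∫ x, |u x t| ^ (2 * p - 2) * spaceDeriv u x t ^ 2 ≤
      (p * halfOsc b t) ^ 2 * ∫ x, |u x t| ^ (2 * p) := by
  have hD := hE.integrable_dissipation
  have hid := hE.identity
  simp only [sq_abs] at hD hid
  set I := ∫ x, |u x t| ^ (2 * p - 2) * spaceDeriv u x t ^ 2 with hI
  set X := ∫ x, |u x t| ^ (2 * p) with hXdef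
  have h1 : ∫ x, (b x t - midValue b t) * |u x t| ^ (2 * p - 2) * u x t * spaceDeriv u x t ≤
      1 / 2 * I + halfOsc b t ^ 2 / 2 * X := by
    rw [hI, hXdef, ← integral_const_mul, ← integral_const_mul,
      ← integral_add (hD.const_mul _) (hX.const_mul _)]
    refine integral_mono hE.integrable_advection ((hD.const_mul _).add (hX.const_mul _))
      fun x => ?_
    have h2 := (le_abs_self _).trans (abs_advection_le (b := fun x t => b x t - midValue b t)
      (u := u) (by linarith : 2 ≤ 2 * p) (hb.abs_sub_midValue_le ht x))
    unfold advection dissipation at h2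
    refine le_trans (le_of_eq ?_) h2
    ring
  have hc : 0 < 2 * p * (2 * p - 1) := by
    have : 0 < 2 * p - 1 := by linarith
    positivity
  have h3 : 2 * p * (2 * p - 1) * I ≤
      2 * p * (2 * p - 1) * (1 / 2 * I + halfOsc b t ^ 2 / 2 * X) :=
    le_trans (by linarith) (mul_le_mul_of_nonneg_left h1 hc.le)
  have h4 := le_of_mul_le_mul_left h3 hc
  rw [mul_pow, mul_assoc]
  gcongr
  linarith

end Solution

/-! ### Constants and the theorem. -/

theorem nashConst_nonneg : 0 ≤ nashConst := by unfold nashConst; positivity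

theorem supConst_nonneg : 0 ≤ supConst := by unfold supConst; positivity

theorem nashConst_pow_three : nashConst ^ 3 = 3 * √3 / (4 * Real.pi) := by
  rw [nashConst, ← Real.rpow_natCast, ← Real.rpow_mul (by positivity)]
  norm_num

theorem supConst_pow_three : supConst ^ 3 = 9 / 16 := by
  rw [supConst, ← Real.rpow_natCast, ← Real.rpow_mul (by positivity)]
  norm_num

theorem theorem2p2 (p₀ q : ℝ) (hp₀ : 1 ≤ p₀) (hq : 2 * p₀ ≤ q)
    (b : ℝ → ℝ → ℝ) (hb : IsAdvectionField b)
    (T : EReal) (hT : 0 < T)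
    (u : ℝ → ℝ → ℝ) (hu : IsSolution b p₀ T u) :
    (∀ t : ℝ, 0 ≤ t → (t : EReal) < T →
      MemLp (fun x => u x t) (ENNReal.ofReal (q / 2)) volume ∧
      MemLp (fun x => u x t) (ENNReal.ofReal q) volume) ∧
    volume (exceptionalTimes b u T q) = 0 ∧
    ∀ t : ℝ, 0 ≤ t → (t : EReal) < T → t ∉ exceptionalTimes b u T q →
      0 ≤ derivWithin (normPow u q) (Ici 0) t →
      eLpNorm (fun x => u x t) (ENNReal.ofReal q) volume
          ≤ ENNReal.ofReal ((q / 2 * nashConst ^ 3) ^ (1 / q) * halfOsc b t ^ (1 / q))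
            * eLpNorm (fun x => u x t) (ENNReal.ofReal (q / 2)) volume ∧
      eLpNorm (fun x => u x t) ⊤ volume
          ≤ ENNReal.ofReal ((q / 2 * nashConst * supConst) ^ (2 / q) * halfOsc b t ^ (2 / q))
            * eLpNorm (fun x => u x t) (ENNReal.ofReal (q / 2)) volume := by
  have hmem : ∀ t : ℝ, 0 ≤ t → (t : EReal) < T →
      MemLp (fun x => u x t) (ENNReal.ofReal (q / 2)) volume ∧
      MemLp (fun x => u x t) (ENNReal.ofReal q) volume := fun t ht htT =>
    ⟨hu.memLp hb hT hp₀ (by linarith) ht htT, hu.memLp hb hT hp₀ (by linarith) ht htT⟩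
  refine ⟨hmem, volume_exceptionalTimes hb hT hu hp₀ hq, fun t ht htT hnot hd => ?_⟩
  have hE : EnergyIdentityAt b u q t := by
    by_contra h
    exact hnot ⟨ht, htT, h⟩
  obtain ⟨p, rfl⟩ : ∃ p, q = 2 * p := ⟨q / 2, by ring⟩
  have hp : 1 ≤ p := by linarith
  have hp0 : 0 < p := by linarith
  obtain ⟨hm1, hm2⟩ := hmem t ht htT
  rw [mul_div_cancel_left₀ p two_ne_zero] at hm1 ⊢
  have hA : Integrable fun x => |u x t| ^ p := integrable_abs_rpow_of_memLp hp0 hm1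
  have hX : Integrable fun x => |u x t| ^ (2 * p) :=
    integrable_abs_rpow_of_memLp (by linarith) hm2
  have hI : Integrable fun x => |u x t| ^ (2 * p - 2) * spaceDeriv u x t ^ 2 := by
    simpa only [sq_abs] using hE.integrable_dissipation
  -- Differentiability is taken from the energy identity rather than from the equation, so t = 0 is
  -- covered.
  have hw : ∀ x, HasDerivAt (fun y => u y t) (spaceDeriv u x t) x :=
    fun x => (hE.differentiable x).hasDerivAt
  have hB := hb.halfOsc_nonneg ht
  have hκ : 0 ≤ p * halfOsc b t := by positivity
  have hD := hE.dissipation_le hb hp ht hX hd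
  have hA0 : 0 ≤ ∫ x, |u x t| ^ p := integral_nonneg fun x => by positivity
  have hX0 : 0 ≤ ∫ x, |u x t| ^ (2 * p) := integral_nonneg fun x => by positivity
  have hC2 := nashConst_nonneg
  have hCi := supConst_nonneg
  rw [eLpNorm_ofReal_eq hp0 hm1]
  constructor
  · rw [eLpNorm_ofReal_eq (by linarith) hm2, ← ENNReal.ofReal_mul (by positivity)]
    refine ENNReal.ofReal_le_ofReal ?_
    have h := integral_le_of_dissipation_le hp hw hA hX hI hκ hD
    rw [← nashConst_pow_three] at h
    refine (Real.rpow_le_rpow hX0 h (by positivity)).trans (le_of_eq ?_)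
    have e : (∫ x, |u x t| ^ p) ^ (1 / p) = ((∫ x, |u x t| ^ p) ^ 2) ^ (1 / (2 * p)) := by
      rw [← Real.rpow_natCast, ← Real.rpow_mul hA0]
      congr 1
      push_cast
      field_simp
    rw [e, ← Real.mul_rpow (by positivity) hB, ← Real.mul_rpow (by positivity) (by positivity)]
    congr 1
    ring
  · rw [eLpNorm_exponent_top, ← ENNReal.ofReal_mul (by positivity)]
    refine eLpNormEssSup_le_of_ae_bound (ae_of_all _ fun x => ?_)
    have h := abs_rpow_pow_three_le_of_dissipation_le hp hw hA hX hI hκ hD x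
    -- The right side becomes a perfect cube; a cube root followed by a p-th root gives the exponent
    -- 1/p = 2/q.
    rw [← nashConst_pow_three, ← supConst_pow_three, ← mul_pow, ← mul_pow] at h
    have h2 := (pow_le_pow_iff_left₀ (by positivity) (by positivity) three_ne_zero).1 h
    have h3 := Real.rpow_le_rpow (by positivity) h2 (by positivity : 0 ≤ 1 / p)
    rw [one_div, Real.rpow_rpow_inv (abs_nonneg _) hp0.ne'] at h3
    rw [Real.norm_eq_abs, show 2 / (2 * p) = p⁻¹ by field_simp, one_div,
      ← Real.mul_rpow (by positivity) hB, ← Real.mul_rpow (by positivity) hA0]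
    refine h3.trans (le_of_eq ?_)
    congr 1
    ring
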